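/- Let $R\subset\mathbb R^N$ be a reduced crystallographic root system (spanning $\mathbb R^N$, with reflections orthogonal for the standard inner product), let $V=\mathbb C^N$ with the standard $\mathbb C$-bilinear form $(\cdot,\cdot)$, let $W$ be the Weyl group, $P$ the weight lattice, $R_+$ a positive subsystem and $\Gamma$ the corresponding Coxeter graph, whose vertices are identified with the simple roots. Let $c\colon R\to\mathbb C$ be a $W$-invariant function and put $\rho=\tfrac12\sum_{\alpha\in R_+}c_\alpha\alpha$. The trigonometric Cherednik algebra is the algebra of operators on the group algebra $\mathbb C[\{e^{(\mu,x)}\mid\mu\in P\}]$ generated by $W$, the multiplications by $e^{(\mu,x)}$ ($\mu\in P$) and the trigonometric Dunkl operators $$\nabla_\xi=\partial_\xi-\sum_{\alpha\in R_+}\frac{c_\alpha(\alpha,\xi)}{1-e^{-(\alpha,x)}}(1-s_\alpha)+(\rho,\xi)\qquad(\xi\in V).$$ Let $\Gamma_0\subseteq\Gamma$ be a full subgraph, $\Gamma_0^v$ the set of simple roots that are its vertices, $\pi=\{x\in V\mid(\beta,x)=0\ \forall\beta\in\Gamma_0^v\}$ and $D_{\Gamma_0}=\bigcup_{w\in W}w(\pi)$.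 Let $x_0\in\pi$ be generic, meaning that if $e^{(\alpha,x_0)}=1$ for some $\alpha\in R$, then $\alpha\in\operatorname{span}\Gamma_0^v$. Let $U$ be a non-zero complex vector space, and let $\mathcal C_{Wx_0}(V,U)=U\otimes\bigoplus_{x\in Wx_0}\mathcal C_x(V)$, where $\mathcal C_x(V)$ is the space of germs at $x$ of analytic functions on $V$. The trigonometric Cherednik algebra acts on $\mathcal C_{Wx_0}(V,U)$ by letting its generators act on the germs by the same formulas, tensored with $\mathrm{id}_U$, where $(wf)(y)=f(w^{-1}y)$ for $w\in W$. Let $\mathcal I_{\Gamma_0}\subseteq\mathcal C_{Wx_0}(V,U)$ be the subspace of the elements that vanish when restricted to $D_{\Gamma_0}$. **Theorem.** Let $\Gamma_0=\coprod_{i=1}^l\Gamma_i$ be the decomposition into connected components, and let $V_i\subseteq V$ be the linear span of the simple roots that are vertices of $\Gamma_i$. Then $\mathcal I_{\Gamma_0}$ is invariant under the trigonometric Cherednik algebra if and only if for all $i=1,\dots,l$ $$\sum_{\alpha\in R\cap V_i}\frac{c_\alpha(\alpha,u)(\alpha,v)}{(\alpha,\alpha)}=(u,v)\qquad\text{for all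 }u,v\in V_i.$$ -/

import Mathlib

open scoped Matrix Topology TensorProduct

noncomputable section

namespace TrigCherednik

/-! ### Root systems in Euclidean space and their complexification -/

section Roots

variable {N : ℕ} {ι Y : Type*} [AddCommGroup Y] [Module ℝ Y]

/-- The reflections of the root system `P` in `ℝ^N` preserve the standard inner product,
i.e. they are the orthogonal reflections about the hyperplanes orthogonal to the roots. -/
class ActsOrthogonally (P : RootPairing ι ℝ (Fin N → ℝ) Y) : Prop where
  dotProduct_reflection : ∀ (i : ι) (x y : Fin N → ℝ),
    P.reflection i x ⬝ᵥ P.reflection i y = x ⬝ᵥ y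

variable (P : RootPairing ι ℝ (Fin N → ℝ) Y)

/-- The root `α_i` as a vector of `V = ℂ^N`. The standard `ℂ`-bilinear form on `V` is `⬝ᵥ`. -/
def croot (i : ι) : Fin N → ℂ := fun k => (P.root i k : ℂ)

theorem croot_dotProduct_ofReal (i : ι) (x : Fin N → ℝ) :
    (croot P i ⬝ᵥ fun k => (x k : ℂ)) = ((P.root i ⬝ᵥ x : ℝ) : ℂ) := by
  simp [croot, dotProduct]

theorem croot_dotProduct_croot (i j : ι) :
    croot P i ⬝ᵥ croot P j = ((P.root i ⬝ᵥ P.root j : ℝ) : ℂ) :=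
  croot_dotProduct_ofReal P i (P.root j)

theorem root_dotProduct_self_ne_zero (i : ι) : P.root i ⬝ᵥ P.root i ≠ 0 := by
  rw [Ne, dotProduct_self_eq_zero]
  exact P.ne_zero i

theorem croot_dotProduct_self_ne_zero (i : ι) : croot P i ⬝ᵥ croot P i ≠ 0 := by
  rw [croot_dotProduct_croot]
  exact_mod_cast root_dotProduct_self_ne_zero P i

/-- The linear form `x ↦ 2 (α_i, x) / (α_i, α_i)` on `V`. -/
def coform (i : ι) : Module.Dual ℂ (Fin N → ℂ) :=
  (2 / (croot P i ⬝ᵥ croot P i)) • dotProductBilin ℂ ℂ (croot P i)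

theorem coform_apply (i : ι) (x : Fin N → ℂ) :
    coform P i x = 2 / (croot P i ⬝ᵥ croot P i) * (croot P i ⬝ᵥ x) := rfl

theorem coform_croot (i : ι) : coform P i (croot P i) = 2 := by
  rw [coform_apply, div_mul_cancel₀ _ (croot_dotProduct_self_ne_zero P i)]

/-- The orthogonal reflection `s_α x = x - 2 (α, x) / (α, α) α` of `V = ℂ^N`, `α = α_i`. -/
def refl (i : ι) : (Fin N → ℂ) ≃ₗ[ℂ] (Fin N → ℂ) := Module.reflection (coform_croot P i)

theorem refl_apply (i : ι) (x : Fin N → ℂ) :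
    refl P i x = x - coform P i x • croot P i := rfl

/-- The Weyl group `W`, acting on `V = ℂ^N`. -/
def weylGroup : Subgroup ((Fin N → ℂ) ≃ₗ[ℂ] (Fin N → ℂ)) :=
  Subgroup.closure (Set.range (refl P))

theorem refl_mem (i : ι) : refl P i ∈ weylGroup P := Subgroup.subset_closure ⟨i, rfl⟩

/-- The reflection `s_α` as an element of `W`. -/
def wrefl (i : ι) : weylGroup P := ⟨refl P i, refl_mem P i⟩

theorem refl_dotProduct_refl (i : ι) (x y : Fin N → ℂ) :
    refl P i x ⬝ᵥ refl P i y = x ⬝ᵥ y := by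
  have h := croot_dotProduct_self_ne_zero P i
  simp only [refl_apply, coform_apply, sub_dotProduct, dotProduct_sub, smul_dotProduct,
    dotProduct_smul, smul_eq_mul, dotProduct_comm x (croot P i)]
  field_simp
  ring

theorem weyl_dotProduct {w : (Fin N → ℂ) ≃ₗ[ℂ] (Fin N → ℂ)} (hw : w ∈ weylGroup P)
    (x y : Fin N → ℂ) : w x ⬝ᵥ w y = x ⬝ᵥ y := by
  induction hw using Subgroup.closure_induction generalizing x y with
  | mem w h => obtain ⟨i, rfl⟩ := h; exact refl_dotProduct_refl P i x y
  | one => rfl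
  | mul a b _ _ ha hb => exact (ha _ _).trans (hb _ _)
  | inv a _ ha =>
    have h1 : ∀ z, a (a⁻¹ z) = z := fun z => a.apply_symm_apply z
    rw [← ha, h1, h1]

variable [ActsOrthogonally P]

theorem coroot'_eq (i : ι) (x : Fin N → ℝ) :
    P.coroot' i x = 2 / (P.root i ⬝ᵥ P.root i) * (P.root i ⬝ᵥ x) := by
  have h := ActsOrthogonally.dotProduct_reflection (P := P) i x (P.root i)
  rw [P.reflection_apply_self, P.reflection_apply, sub_dotProduct, dotProduct_neg, smul_dotProduct,
    dotProduct_neg, smul_eq_mul, dotProduct_comm x] at h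
  have h0 := root_dotProduct_self_ne_zero P i
  field_simp
  linarith

theorem coform_croot_eq (i j : ι) : coform P i (croot P j) = ((P.pairing j i : ℝ) : ℂ) := by
  rw [← P.root_coroot'_eq_pairing, coroot'_eq, coform_apply, croot_dotProduct_croot,
    croot_dotProduct_croot]
  push_cast
  rfl

theorem refl_croot (i j : ι) : refl P i (croot P j) = croot P (P.reflectionPerm i j) := by
  rw [refl_apply, coform_croot_eq]
  ext k
  simp [croot, P.reflection_apply_root]

theorem weyl_croot {w : (Fin N → ℂ) ≃ₗ[ℂ] (Fin N → ℂ)} (hw : w ∈ weylGroup P) :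
    ∀ j, ∃ k, w (croot P j) = croot P k := by
  induction hw using Subgroup.closure_induction_left with
  | one => exact fun j => ⟨j, rfl⟩
  | mul_left a ha b _ hb =>
    intro j
    obtain ⟨i, rfl⟩ := ha
    obtain ⟨k, hk⟩ := hb j
    exact ⟨P.reflectionPerm i k, by rw [← refl_croot, ← hk]; rfl⟩
  | inv_mul_cancel a ha b _ hb =>
    intro j
    obtain ⟨i, rfl⟩ := ha
    obtain ⟨k, hk⟩ := hb j
    exact ⟨P.reflectionPerm i k, by rw [← refl_croot, ← hk]; rfl⟩

end Roots

/-! ### The Coxeter graph and its subgraphs -/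

section Graph

variable {N : ℕ} {ι Y : Type*} [AddCommGroup Y] [Module ℝ Y]
  {P : RootPairing ι ℝ (Fin N → ℝ) Y} (b : P.Base)

/-- The Coxeter graph: its vertices are the simple roots, and two distinct vertices are joined
when the simple roots are not orthogonal (i.e. the simple reflections do not commute). -/
def coxeterGraph : SimpleGraph b.support where
  Adj i j := i ≠ j ∧ P.root i ⬝ᵥ P.root j ≠ 0
  symm := ⟨fun _ _ h => ⟨h.1.symm, by rw [dotProduct_comm]; exact h.2⟩⟩
  loopless := ⟨fun _ h => h.1 rfl⟩

variable (Γ₀ : Set b.support)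

/-- The plane `π` cut out by the simple roots of `Γ₀`. -/
def plane : Set (Fin N → ℂ) := {x | ∀ i ∈ Γ₀, croot P i ⬝ᵥ x = 0}

/-- The stratum `D_{Γ₀}`, the union of the planes `w(π)`, `w ∈ W`. -/
def stratum : Set (Fin N → ℂ) := ⋃ w ∈ weylGroup P, w '' plane b Γ₀

/-- `x₀` is a generic point of `π`: if `e^{(α, x₀)} = 1` for a root `α`, then `α` lies in the
span of the simple roots of `Γ₀`. -/
structure IsGeneric (x₀ : Fin N → ℂ) : Prop where
  mem_plane : x₀ ∈ plane b Γ₀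
  mem_span : ∀ i, Complex.exp (croot P i ⬝ᵥ x₀) = 1 →
    croot P i ∈ Submodule.span ℂ ((fun j : b.support => croot P j) '' Γ₀)

variable {b Γ₀} in
/-- The subspace `V_C` of `V` spanned by the simple roots in the connected component `C` of the
full subgraph on `Γ₀`. -/
def componentSpace (C : ((coxeterGraph b).induce Γ₀).ConnectedComponent) :
    Submodule ℂ (Fin N → ℂ) :=
  Submodule.span ℂ ((fun j : Γ₀ => croot P j) '' C.supp)

end Graph

/-! ### The trigonometric Cherednik algebra, acting on the group algebra of the weight lattice -/

section Algebra

variable {N : ℕ} {ι Y : Type*} [AddCommGroup Y] [Module ℝ Y]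
  (P : RootPairing ι ℝ (Fin N → ℝ) Y)

/-- The weight lattice: all `μ` with `2 (α, μ) / (α, α) ∈ ℤ` for every root `α` (as the roots span
`ℝ^N`, such a `μ ∈ ℂ^N` is automatically real). -/
def weightLattice : AddSubgroup (Fin N → ℂ) where
  carrier := {μ | ∀ i, ∃ n : ℤ, coform P i μ = n}
  zero_mem' i := ⟨0, by simp⟩
  add_mem' {x y} hx hy i := by
    obtain ⟨m, hm⟩ := hx i
    obtain ⟨n, hn⟩ := hy i
    exact ⟨m + n, by rw [map_add, hm, hn]; push_cast; rfl⟩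
  neg_mem' {x} hx i := by
    obtain ⟨m, hm⟩ := hx i
    exact ⟨-m, by rw [map_neg, hm]; push_cast; rfl⟩

/-- The integer `2 (α_i, μ) / (α_i, α_i)` for a weight `μ`. -/
def weightPairing (i : ι) (μ : weightLattice P) : ℤ := (μ.2 i).choose

theorem weightPairing_spec (i : ι) (μ : weightLattice P) :
    coform P i μ = weightPairing P i μ := (μ.2 i).choose_spec

variable [ActsOrthogonally P]

theorem weyl_mem_weightLattice (w : weylGroup P) {μ : Fin N → ℂ} (hμ : μ ∈ weightLattice P) :
    w.1 μ ∈ weightLattice P := by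
  intro i
  obtain ⟨k, hk⟩ := weyl_croot P (inv_mem w.2) i
  have h1 : w.1 (w.1⁻¹ (croot P i)) = croot P i := w.1.apply_symm_apply _
  obtain ⟨n, hn⟩ := hμ k
  refine ⟨n, ?_⟩
  rw [← hn, coform_apply, coform_apply, ← hk, ← weyl_dotProduct P w.2 _ μ, h1,
    weyl_dotProduct P (inv_mem w.2)]

theorem croot_mem_weightLattice [P.IsCrystallographic] (i : ι) : croot P i ∈ weightLattice P := by
  intro j
  obtain ⟨n, hn⟩ := P.exists_value (S := ℤ) i j
  exact ⟨n, by rw [coform_croot_eq, ← hn]; simp⟩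

/-- A root as a weight. -/
def rootWeight [P.IsCrystallographic] (i : ι) : weightLattice P :=
  ⟨croot P i, croot_mem_weightLattice P i⟩

/-- `w` acts on the group algebra by `e^μ ↦ e^{w μ}`. -/
def polyWeyl (w : weylGroup P) : Module.End ℂ (AddMonoidAlgebra ℂ (weightLattice P)) :=
  AddMonoidAlgebra.mapDomainLinearMap ℂ ℂ
    (fun μ => (⟨w.1 μ, weyl_mem_weightLattice P w μ.2⟩ : weightLattice P))

variable {P} in
/-- Multiplication by `e^μ` on the group algebra. -/
def polyExp (μ : weightLattice P) : Module.End ℂ (AddMonoidAlgebra ℂ (weightLattice P)) :=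
  LinearMap.mulLeft ℂ (AddMonoidAlgebra.single μ 1)

/-- The derivation `∂_ξ` of the group algebra, `e^μ ↦ (μ, ξ) e^μ`. -/
def polyDeriv (ξ : Fin N → ℂ) : Module.End ℂ (AddMonoidAlgebra ℂ (weightLattice P)) :=
  (AddMonoidAlgebra.basis (weightLattice P) ℂ).constr ℂ
    fun μ => AddMonoidAlgebra.single μ ((μ : Fin N → ℂ) ⬝ᵥ ξ)

variable [P.IsCrystallographic]

/-- The operator `(1 - e^{-α})⁻¹ (1 - s_α)` on the group algebra, `α = α_i`. On `e^μ` with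
`m = 2 (α, μ) / (α, α)` it is `e^μ + e^{μ - α} + ⋯ + e^{μ - (m - 1) α}` if `m ≥ 0`, and
`-(e^{μ + α} + ⋯ + e^{μ + |m| α})` if `m < 0`. -/
def polyDiff (i : ι) : Module.End ℂ (AddMonoidAlgebra ℂ (weightLattice P)) :=
  (AddMonoidAlgebra.basis (weightLattice P) ℂ).constr ℂ fun μ =>
    if 0 ≤ weightPairing P i μ then
      ∑ j ∈ Finset.range (weightPairing P i μ).toNat,
        AddMonoidAlgebra.single (μ - j • rootWeight P i) 1
    else
      -∑ j ∈ Finset.range (-weightPairing P i μ).toNat,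
        AddMonoidAlgebra.single (μ + (j + 1) • rootWeight P i) 1

theorem polyDiff_spec (i : ι) (f : AddMonoidAlgebra ℂ (weightLattice P)) :
    (1 - AddMonoidAlgebra.single (-rootWeight P i) 1) * polyDiff P i f =
      f - polyWeyl P (wrefl P i) f := by
  have key : LinearMap.mulLeft ℂ (1 - AddMonoidAlgebra.single (-rootWeight P i) (1 : ℂ)) ∘ₗ
      polyDiff P i = LinearMap.id - polyWeyl P (wrefl P i) := by
    refine (AddMonoidAlgebra.basis (weightLattice P) ℂ).ext fun μ => ?_
    have hs : (⟨(wrefl P i).1 μ, weyl_mem_weightLattice P (wrefl P i) μ.2⟩ : weightLattice P) =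
        μ - weightPairing P i μ • rootWeight P i := by
      ext1
      have : (wrefl P i).1 (μ : Fin N → ℂ) = μ - coform P i μ • croot P i := rfl
      simp only [this, weightPairing_spec, AddSubgroup.coe_sub, AddSubgroup.coe_zsmul, rootWeight,
        Int.cast_smul_eq_zsmul]
    rw [LinearMap.comp_apply, polyDiff, Module.Basis.constr_basis]
    simp only [LinearMap.sub_apply, LinearMap.id_apply, AddMonoidAlgebra.basis_apply, polyWeyl,
      AddMonoidAlgebra.mapDomainLinearMap_single, hs, LinearMap.mulLeft_apply]
    split_ifs with h
    · obtain ⟨n, hn⟩ := Int.eq_ofNat_of_zero_le h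
      rw [hn, Int.toNat_natCast, natCast_zsmul]
      clear hn h hs
      induction n with
      | zero => simp
      | succ n ih =>
        rw [Finset.sum_range_succ, mul_add, ih, sub_mul, one_mul,
          AddMonoidAlgebra.single_mul_single, one_mul, succ_nsmul]
        have : -rootWeight P i + (μ - n • rootWeight P i) =
          μ - (n • rootWeight P i + rootWeight P i) := by abel
        rw [this]
        abel
    · obtain ⟨n, hn⟩ := Int.eq_ofNat_of_zero_le (a := -weightPairing P i μ) (by lia)
      rw [hn, Int.toNat_natCast, ← neg_neg (weightPairing P i μ), hn, neg_smul, sub_neg_eq_add,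
        natCast_zsmul]
      clear hn h hs
      induction n with
      | zero => simp
      | succ n ih =>
        rw [Finset.sum_range_succ, neg_add, mul_add, ih, sub_mul, one_mul, mul_neg,
          AddMonoidAlgebra.single_mul_single, one_mul]
        have : -rootWeight P i + (μ + (n + 1) • rootWeight P i) =
          μ + n • rootWeight P i := by rw [succ_nsmul]; abel
        rw [this]
        abel
  exact LinearMap.congr_fun key f

/-- Names for the generators of the trigonometric Cherednik algebra: the elements of `W`, the
exponentials `e^μ` of the weights, and the Dunkl operators in the directions `ξ ∈ V`. -/
inductive Generator
  | weyl (w : weylGroup P)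
  | exp (μ : weightLattice P)
  | dunkl (ξ : Fin N → ℂ)

variable [Fintype ι] {P} (b : P.Base) (c : ι → ℂ)

open Classical in
/-- The generalised Weyl vector `ρ = ½ ∑_{α ∈ R₊} c_α α`. -/
def weylVector : Fin N → ℂ := (1 / 2 : ℂ) • ∑ i with b.IsPos i, c i • croot P i

open Classical in
/-- The trigonometric Dunkl operator on the group algebra of the weight lattice. -/
def polyDunkl (ξ : Fin N → ℂ) : Module.End ℂ (AddMonoidAlgebra ℂ (weightLattice P)) :=
  polyDeriv P ξ - ∑ i with b.IsPos i, (c i * (croot P i ⬝ᵥ ξ)) • polyDiff P i +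
    (weylVector b c ⬝ᵥ ξ) • LinearMap.id

/-- The generators as operators on the group algebra of the weight lattice. -/
def polyGenerator : Generator P → Module.End ℂ (AddMonoidAlgebra ℂ (weightLattice P))
  | .weyl w => polyWeyl P w
  | .exp μ => polyExp μ
  | .dunkl ξ => polyDunkl b c ξ

/-- The trigonometric Cherednik algebra: the algebra of operators on the group algebra of the
weight lattice generated by `W`, the exponentials and the trigonometric Dunkl operators. -/
def trigCherednikAlgebra : Subalgebra ℂ (Module.End ℂ (AddMonoidAlgebra ℂ (weightLattice P))) :=
  Algebra.adjoin ℂ (Set.range (polyGenerator b c))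

end Algebra

/-! ### Division by a linear form -/

/-- Division with remainder zero: if `h - A h = ℓ h • a`, the function `f (x + h) - f (x + A h)`
is divisible by the linear form `ℓ` among functions of `h` analytic at `0`. -/
theorem exists_analyticAt_smul_eq {E : Type*} [NormedAddCommGroup E] [NormedSpace ℂ E]
    {f : E → ℂ} {x : E} (hf : AnalyticAt ℂ f x) (A : E →L[ℂ] E) (l : E →L[ℂ] ℂ) (a : E)
    (hA : ∀ h, h - A h = l h • a) :
    ∃ g : E → ℂ, AnalyticAt ℂ g 0 ∧
      ∀ᶠ h in 𝓝 (0 : E), f (x + h) - f (x + A h) = l h * g h := by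
  obtain ⟨p, R, hp⟩ := hf
  let q : FormalMultilinearSeries ℂ E ℂ := fun n => ∑ k : Fin (n + 1),
    ((p (n + 1)).curryMid k a).compContinuousLinearMap
      (fun i => if i.castSucc < k then ContinuousLinearMap.id ℂ E else A)
  have hq : ∀ (n : ℕ) (h : E),
      (p (n + 1) fun _ => h) - (p (n + 1) fun _ => A h) = l h * q n (fun _ => h) := by
    intro n h
    have := (p (n + 1)).toMultilinearMap.map_piecewise_sub_map_piecewise
      (fun _ => h) (fun _ => A h) (fun _ => h) Finset.univ
    simp only [Finset.piecewise_univ, ContinuousMultilinearMap.coe_coe, Finset.mem_univ,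
      if_true] at this
    rw [this]
    simp only [q, sum_apply, Finset.mul_sum]
    refine Finset.sum_congr rfl fun k _ => ?_
    simp only [ContinuousMultilinearMap.compContinuousLinearMap_apply,
      ContinuousMultilinearMap.curryMid_apply]
    rw [← smul_eq_mul]
    have h1 := (p (n + 1)).map_update_smul (k.insertNth a fun i => (if i.castSucc < k then
      ContinuousLinearMap.id ℂ E else A) h) k (l h) a
    simp only [Fin.update_insertNth] at h1
    rw [← h1]
    congr 1
    ext j
    refine Fin.succAboveCases k ?_ (fun i => ?_) j
    · simp [hA]
    · rw [Fin.insertNth_apply_succAbove]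
      by_cases hi : i.castSucc < k
      · simp [Fin.succAbove_lt_iff_castSucc_lt, hi]
      · simp [Fin.succAbove_lt_iff_castSucc_lt, hi, Fin.succAbove_ne]
  obtain ⟨r, hr0, hrR⟩ := ENNReal.lt_iff_exists_nnreal_btwn.1 (hp.r_pos.trans_le hp.r_le)
  have hr0 : (0 : ℝ) < r := by exact_mod_cast hr0
  obtain ⟨K, hK0, hK⟩ := p.norm_mul_pow_le_of_lt_radius hrR
  let C : NNReal := max 1 ‖A‖₊
  have hC1 : (1 : ℝ) ≤ C := by exact_mod_cast le_max_left _ _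
  have hCA : ‖A‖ ≤ C := by exact_mod_cast le_max_right _ _
  have hqn : ∀ n, ‖q n‖ ≤ (n + 1) * (‖p (n + 1)‖ * ‖a‖ * (C : ℝ) ^ n) := by
    intro n
    refine (norm_sum_le _ _).trans ?_
    have : ∀ k : Fin (n + 1), ‖((p (n + 1)).curryMid k a).compContinuousLinearMap
      (fun i => if i.castSucc < k then ContinuousLinearMap.id ℂ E else A)‖ ≤
        ‖p (n + 1)‖ * ‖a‖ * (C : ℝ) ^ n := by
      intro k
      refine (ContinuousMultilinearMap.norm_compContinuousLinearMap_le _ _).trans ?_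
      gcongr
      · refine (ContinuousLinearMap.le_opNorm _ _).trans ?_
        rw [ContinuousMultilinearMap.norm_curryMid]
      · refine (Finset.prod_le_prod (fun _ _ => norm_nonneg _) (g := fun _ => (C : ℝ))
          fun i _ => ?_).trans (by simp)
        split_ifs
        · exact (ContinuousLinearMap.norm_id_le).trans hC1
        · exact hCA
    refine (Finset.sum_le_sum fun k _ => this k).trans ?_
    simp
  have hrad : 0 < q.radius := by
    refine lt_of_lt_of_le ?_ (q.le_radius_of_bound (r := r / (2 * C)) (K * ‖a‖ / r) fun n => ?_)
    · have : 0 < r / (2 * C) := by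
        have : (0 : NNReal) < r := by exact_mod_cast hr0
        have : (0 : NNReal) < C := lt_of_lt_of_le one_pos (le_max_left _ _)
        positivity
      exact_mod_cast this
    · have h2 : ((n : ℝ) + 1) ≤ 2 ^ n := by exact_mod_cast Nat.lt_two_pow_self (n := n)
      have hCpos : (0 : ℝ) < C := by linarith
      calc ‖q n‖ * ((r / (2 * C) : NNReal) : ℝ) ^ n
          ≤ ((n + 1) * (‖p (n + 1)‖ * ‖a‖ * (C : ℝ) ^ n)) * ((r / (2 * C) : NNReal) : ℝ) ^ n := by
            gcongr; exact hqn n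
        _ = ((n + 1) / 2 ^ n) * ((‖p (n + 1)‖ * (r : ℝ) ^ (n + 1)) * ‖a‖ / r) := by
            push_cast
            rw [div_pow, mul_pow, pow_succ]
            field_simp
        _ ≤ 1 * (K * ‖a‖ / r) := by
            gcongr
            · rw [div_le_one (by positivity)]; exact h2
            · exact hK _
        _ = _ := one_mul _
  have hqs := q.hasFPowerSeriesOnBall hrad
  refine ⟨q.sum, hqs.analyticAt, ?_⟩
  have e1 : ∀ᶠ h in 𝓝 (0 : E), h ∈ Metric.eball (0 : E) R := Metric.eball_mem_nhds _ hp.r_pos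
  have e2 : ∀ᶠ h in 𝓝 (0 : E), A h ∈ Metric.eball (0 : E) R := by
    have : Filter.Tendsto A (𝓝 0) (𝓝 0) := by simpa using A.continuous.tendsto 0
    exact this.eventually e1
  have e3 : ∀ᶠ h in 𝓝 (0 : E), h ∈ Metric.eball (0 : E) q.radius := Metric.eball_mem_nhds _ hrad
  filter_upwards [e1, e2, e3] with h h1 h2 h3
  have s1 := (hp.hasSum h1).sub (hp.hasSum h2)
  have s2 := (hqs.hasSum h3).mul_left (l h)
  rw [zero_add] at s2
  have s3 := (hasSum_nat_add_iff' 1).2 s1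
  simp only [← hq] at s2
  have p0 : (p 0 fun _ => h) = p 0 fun _ => A h := by congr 1; ext i; exact i.elim0
  simp only [Finset.range_one, Finset.sum_singleton, p0, sub_self, sub_zero] at s3
  exact s3.unique s2

/-! ### Germs near an orbit and the action on them -/

section Germs

variable {N : ℕ}

/-- Germs along a set `O` of functions analytic near the points of `O`. When `O` is finite (an
orbit of the Weyl group) this is the direct sum, over the points `x ∈ O`, of the spaces of germs
at `x` of analytic functions on `V = ℂ^N`. -/
def analyticGerms (O : Set (Fin N → ℂ)) : Submodule ℂ (Filter.Germ (𝓝ˢ O) ℂ) where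
  carrier := {g | ∃ f : (Fin N → ℂ) → ℂ, AnalyticOnNhd ℂ f O ∧ (f : Filter.Germ (𝓝ˢ O) ℂ) = g}
  zero_mem' := ⟨0, fun _ _ => analyticAt_const, rfl⟩
  add_mem' := by
    rintro _ _ ⟨f, hf, rfl⟩ ⟨g, hg, rfl⟩
    exact ⟨f + g, hf.add hg, rfl⟩
  smul_mem' := by
    rintro a _ ⟨f, hf, rfl⟩
    exact ⟨a • f, fun x hx => analyticAt_const.smul (hf x hx), rfl⟩

/-- The germ along `O` of a function analytic near `O`. -/
def germOf {O : Set (Fin N → ℂ)} (f : (Fin N → ℂ) → ℂ) (hf : AnalyticOnNhd ℂ f O) :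
    analyticGerms O := ⟨(f : Filter.Germ (𝓝ˢ O) ℂ), f, hf, rfl⟩

theorem eventuallyEq_nhdsSet {O : Set (Fin N → ℂ)} {f g : (Fin N → ℂ) → ℂ} :
    f =ᶠ[𝓝ˢ O] g ↔ ∀ x ∈ O, f =ᶠ[𝓝 x] g := by
  simp only [Filter.EventuallyEq, Filter.Eventually, mem_nhdsSet_iff_forall]

theorem germOf_eq {O : Set (Fin N → ℂ)} {f g : (Fin N → ℂ) → ℂ} {hf : AnalyticOnNhd ℂ f O}
    {hg : AnalyticOnNhd ℂ g O} : germOf f hf = germOf g hg ↔ ∀ x ∈ O, f =ᶠ[𝓝 x] g := by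
  rw [← eventuallyEq_nhdsSet, ← Filter.Germ.coe_eq]
  exact Subtype.ext_iff

/-- An operation on functions that preserves analyticity near `O`, only depends on the values
near `O`, and is linear near `O` on functions analytic there. -/
structure LocalOperator (O : Set (Fin N → ℂ)) where
  toFun : ((Fin N → ℂ) → ℂ) → (Fin N → ℂ) → ℂ
  analytic : ∀ f, AnalyticOnNhd ℂ f O → AnalyticOnNhd ℂ (toFun f) O
  congr : ∀ f g, (∀ x ∈ O, f =ᶠ[𝓝 x] g) → ∀ x ∈ O, toFun f =ᶠ[𝓝 x] toFun g
  add : ∀ f g, AnalyticOnNhd ℂ f O → AnalyticOnNhd ℂ g O →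
    ∀ x ∈ O, toFun (f + g) =ᶠ[𝓝 x] toFun f + toFun g
  smul : ∀ (a : ℂ) (f), AnalyticOnNhd ℂ f O → ∀ x ∈ O, toFun (a • f) =ᶠ[𝓝 x] a • toFun f

namespace LocalOperator

variable {O : Set (Fin N → ℂ)} (T : LocalOperator O)

theorem germOf_toFun_choose (f : (Fin N → ℂ) → ℂ) (hf : AnalyticOnNhd ℂ f O) :
    germOf (T.toFun (germOf f hf).2.choose) (T.analytic _ (germOf f hf).2.choose_spec.1) =
      germOf (T.toFun f) (T.analytic f hf) := by
  refine germOf_eq.2 (T.congr _ _ ?_)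
  exact eventuallyEq_nhdsSet.1 (Filter.Germ.coe_eq.1 (germOf f hf).2.choose_spec.2)

/-- The linear operator on germs induced by a local operator: the germ of `f` goes to the germ of
`T f`. -/
def toEnd : Module.End ℂ (analyticGerms O) where
  toFun g := germOf (T.toFun g.2.choose) (T.analytic _ g.2.choose_spec.1)
  map_add' := by
    rintro ⟨_, f, hf, rfl⟩ ⟨_, g, hg, rfl⟩
    refine (T.germOf_toFun_choose (f + g) (hf.add hg)).trans ?_
    refine Eq.trans ?_ (congrArg₂ (· + ·) (T.germOf_toFun_choose f hf).symm
      (T.germOf_toFun_choose g hg).symm)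
    exact (germOf_eq (hg := (T.analytic f hf).add (T.analytic g hg))).2 (T.add f g hf hg)
  map_smul' := by
    rintro a ⟨_, f, hf, rfl⟩
    refine (T.germOf_toFun_choose (a • f) fun x hx => analyticAt_const.smul (hf x hx)).trans ?_
    refine Eq.trans ?_ (congrArg (a • ·) (T.germOf_toFun_choose f hf).symm)
    exact (germOf_eq (hg := fun x hx => analyticAt_const.smul (T.analytic f hf x hx))).2
      (T.smul a f hf)

theorem toEnd_germOf (f : (Fin N → ℂ) → ℂ) (hf : AnalyticOnNhd ℂ f O) :
    T.toEnd (germOf f hf) = germOf (T.toFun f) (T.analytic f hf) :=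
  T.germOf_toFun_choose f hf

end LocalOperator

/-- The directional derivative `∂_ξ` on germs. -/
def localDeriv (O : Set (Fin N → ℂ)) (ξ : Fin N → ℂ) : LocalOperator O where
  toFun f y := fderiv ℂ f y ξ
  analytic f hf x hx :=
    ((ContinuousLinearMap.apply ℂ ℂ ξ).analyticAt _).comp (hf x hx).fderiv
  congr f g h x hx := (h x hx).fderiv.mono fun y hy => DFunLike.congr_fun hy ξ
  add f g hf hg x hx := by
    filter_upwards [(hf x hx).eventually_analyticAt, (hg x hx).eventually_analyticAt] with y h1 h2
    simp [fderiv_add h1.differentiableAt h2.differentiableAt]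
  smul a f hf x hx := by
    filter_upwards [(hf x hx).eventually_analyticAt] with y h1
    simp [fderiv_const_smul h1.differentiableAt]

theorem analyticAt_dotProduct (v x : Fin N → ℂ) : AnalyticAt ℂ (fun y => v ⬝ᵥ y) x :=
  (LinearMap.toContinuousLinearMap (dotProductBilin ℂ ℂ v)).analyticAt x

/-- Multiplication by the exponential `e^{(μ, x)}` on germs. -/
def localExp (O : Set (Fin N → ℂ)) (μ : Fin N → ℂ) : LocalOperator O where
  toFun f y := Complex.exp (μ ⬝ᵥ y) * f y
  analytic f hf x hx := (analyticAt_dotProduct μ x).cexp.mul (hf x hx)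
  congr _ _ h x hx := (h x hx).mono fun y hy => by simp only [hy]
  add _ _ _ _ _ _ := Filter.Eventually.of_forall fun y => by simp [mul_add]
  smul _ _ _ _ _ := Filter.Eventually.of_forall fun y => by simp; ring

theorem tendsto_linearEquiv (w : (Fin N → ℂ) ≃ₗ[ℂ] (Fin N → ℂ)) (x : Fin N → ℂ) :
    Filter.Tendsto w (𝓝 x) (𝓝 (w x)) :=
  (LinearMap.toContinuousLinearMap (w : (Fin N → ℂ) →ₗ[ℂ] (Fin N → ℂ))).continuous.tendsto x

theorem analyticAt_comp_linearEquiv {f : (Fin N → ℂ) → ℂ}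
    (w : (Fin N → ℂ) ≃ₗ[ℂ] (Fin N → ℂ)) {x : Fin N → ℂ} (hf : AnalyticAt ℂ f (w x)) :
    AnalyticAt ℂ (fun y => f (w y)) x :=
  hf.comp ((LinearMap.toContinuousLinearMap
    (w : (Fin N → ℂ) →ₗ[ℂ] (Fin N → ℂ))).analyticAt x)

variable {ι Y : Type*} [AddCommGroup Y] [Module ℝ Y] (P : RootPairing ι ℝ (Fin N → ℝ) Y)

/-- The orbit `W x₀`. -/
def orbit (x₀ : Fin N → ℂ) : Set (Fin N → ℂ) := {x | ∃ w ∈ weylGroup P, x = w x₀}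

theorem weyl_mem_orbit {x₀ x : Fin N → ℂ} {w : (Fin N → ℂ) ≃ₗ[ℂ] (Fin N → ℂ)}
    (hw : w ∈ weylGroup P) (hx : x ∈ orbit P x₀) : w x ∈ orbit P x₀ := by
  obtain ⟨v, hv, rfl⟩ := hx
  exact ⟨w * v, mul_mem hw hv, rfl⟩

/-- The action `(w f)(y) = f (w⁻¹ y)` of `w ∈ W` on germs near an orbit; it takes germs at `x` to
germs at `w x`. -/
def localWeyl (x₀ : Fin N → ℂ) (w : weylGroup P) : LocalOperator (orbit P x₀) where
  toFun f y := f (w.1⁻¹ y)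
  analytic f hf x hx :=
    analyticAt_comp_linearEquiv w.1⁻¹ (hf _ (weyl_mem_orbit P (inv_mem w.2) hx))
  congr _ _ h x hx := (tendsto_linearEquiv w.1⁻¹ x).eventually
    (h _ (weyl_mem_orbit P (inv_mem w.2) hx))
  add _ _ _ _ _ _ := Filter.EventuallyEq.rfl
  smul _ _ _ _ _ := Filter.EventuallyEq.rfl

theorem exists_analytic_exp :
    ∃ u : ℂ → ℂ, (∀ z, AnalyticAt ℂ u z) ∧ u 0 = 1 ∧ ∀ z, 1 - Complex.exp (-z) = z * u z := by
  let F : ℂ → ℂ := fun z => 1 - Complex.exp (-z)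
  have hF : Differentiable ℂ F := by fun_prop
  have hd : DifferentiableOn ℂ (dslope F 0) Set.univ :=
    (Complex.differentiableOn_dslope Filter.univ_mem).2 hF.differentiableOn
  refine ⟨dslope F 0, fun z => hd.analyticAt Filter.univ_mem, ?_, fun z => ?_⟩
  · have : HasDerivAt F (-(Complex.exp (-0) * -1)) 0 :=
      ((hasDerivAt_neg (0 : ℂ)).cexp).const_sub 1
    rw [dslope_same, this.deriv]
    simp
  · have := sub_smul_dslope F 0 z
    simp only [F, sub_zero, smul_eq_mul, neg_zero, Complex.exp_zero, sub_self] at this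
    exact this.symm

/-- `(f - s_α f) / (1 - e^{-(α, x)})`, `α = α_i`; on the hyperplane `(α, x) = 0` its value is the
limit `2 / (α, α) ∂_α f`. -/
def divDiff (i : ι) (f : (Fin N → ℂ) → ℂ) (y : Fin N → ℂ) : ℂ :=
  open Classical in
  if croot P i ⬝ᵥ y = 0 then 2 / (croot P i ⬝ᵥ croot P i) * fderiv ℂ f y (croot P i)
  else (f y - f (refl P i y)) / (1 - Complex.exp (-(croot P i ⬝ᵥ y)))

theorem refl_eq_self {i : ι} {y : Fin N → ℂ} (h : croot P i ⬝ᵥ y = 0) : refl P i y = y := by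
  rw [refl_apply, coform_apply, h, mul_zero, zero_smul, sub_zero]

theorem analyticAt_divDiff (i : ι) {f : (Fin N → ℂ) → ℂ} {x : Fin N → ℂ} (hf : AnalyticAt ℂ f x)
    (hfs : AnalyticAt ℂ f (refl P i x))
    (hx : Complex.exp (croot P i ⬝ᵥ x) = 1 → croot P i ⬝ᵥ x = 0) :
    AnalyticAt ℂ (divDiff P i f) x := by
  classical
  have hl := analyticAt_dotProduct (croot P i) x
  have hs : AnalyticAt ℂ (fun y => f (refl P i y)) x := analyticAt_comp_linearEquiv _ hfs
  by_cases h0 : croot P i ⬝ᵥ x = 0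
  · have hne := croot_dotProduct_self_ne_zero P i
    obtain ⟨g, hg, hfg⟩ := exists_analyticAt_smul_eq hf
      (LinearMap.toContinuousLinearMap (refl P i : (Fin N → ℂ) →ₗ[ℂ] (Fin N → ℂ)))
      (LinearMap.toContinuousLinearMap (coform P i)) (croot P i) (fun h => by simp [refl_apply])
    have ht : Filter.Tendsto (fun y => y - x) (𝓝 x) (𝓝 0) := by
      have : Filter.Tendsto (fun y => y - x) (𝓝 x) (𝓝 (x - x)) :=
        (continuous_id.sub continuous_const).tendsto x
      rwa [sub_self] at this
    have hg' : AnalyticAt ℂ (fun y => g (y - x)) x :=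
      AnalyticAt.comp (by rwa [sub_self]) (analyticAt_id.sub analyticAt_const)
    have hfg' : ∀ᶠ y in 𝓝 x, f y - f (refl P i y) = coform P i y * g (y - x) := by
      filter_upwards [ht.eventually hfg] with y hy
      have h1 : coform P i x = 0 := by rw [coform_apply, h0, mul_zero]
      have h2 : x + refl P i (y - x) = refl P i y := by
        rw [map_sub, refl_eq_self P h0]; abel
      have h3 : f (x + (y - x)) - f (x + refl P i (y - x)) =
          coform P i (y - x) * g (y - x) := hy
      rwa [h2, add_sub_cancel, map_sub, h1, sub_zero] at h3
    obtain ⟨u, hu, hu0, hue⟩ := exists_analytic_exp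
    have hul : AnalyticAt ℂ (fun y => u (croot P i ⬝ᵥ y)) x := (hu _).comp hl
    have hux : u (croot P i ⬝ᵥ x) ≠ 0 := by rw [h0, hu0]; exact one_ne_zero
    have hE : (fun y => 2 / (croot P i ⬝ᵥ croot P i) *
        (g (y - x) / u (croot P i ⬝ᵥ y))) =ᶠ[𝓝 x] divDiff P i f := by
      filter_upwards [hfg'.eventually_nhds, hf.eventually_analyticAt, hg'.eventually_analyticAt,
        hul.continuousAt.eventually_ne hux] with y hy hfy hgy huy
      rw [divDiff]
      split_ifs with hy0
      · rw [hy0, hu0, div_one]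
        congr 1
        have hA : HasFDerivAt (fun z => f (refl P i z)) ((fderiv ℂ f y).comp
            (LinearMap.toContinuousLinearMap (refl P i : (Fin N → ℂ) →ₗ[ℂ] (Fin N → ℂ)))) y := by
          have h3 : HasFDerivAt f (fderiv ℂ f y) (refl P i y) := by
            rw [refl_eq_self P hy0]; exact hfy.differentiableAt.hasFDerivAt
          exact h3.comp y (LinearMap.toContinuousLinearMap
            (refl P i : (Fin N → ℂ) →ₗ[ℂ] (Fin N → ℂ))).hasFDerivAt
        have hB := hfy.differentiableAt.hasFDerivAt.sub hA
        have hC := (LinearMap.toContinuousLinearMap (coform P i)).hasFDerivAt (x := y) |>.mul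
          hgy.differentiableAt.hasFDerivAt
        have hD := (hC.congr_of_eventuallyEq hy).unique hB
        have hD := congrArg (fun L => L (croot P i)) hD
        have h4 : refl P i (croot P i) = -croot P i := by
          rw [refl_apply, coform_croot, two_smul]; abel
        have h5 : coform P i y = 0 := by rw [coform_apply, hy0, mul_zero]
        simp [h4, h5, coform_croot] at hD
        linear_combination (1 / 2 : ℂ) * hD
      · have h6 := hy.self_of_nhds
        rw [h6, hue, coform_apply]
        field_simp
    refine AnalyticAt.congr ?_ hE
    exact analyticAt_const.mul (hg'.div hul hux)
  · have hexp : 1 - Complex.exp (-(croot P i ⬝ᵥ x)) ≠ 0 := by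
      rw [Complex.exp_neg, sub_ne_zero]
      intro h
      exact h0 (hx (by rw [← inv_inv (Complex.exp _), ← h, inv_one]))
    refine AnalyticAt.congr ((hf.sub hs).div (analyticAt_const.sub hl.neg.cexp) hexp) ?_
    filter_upwards [hl.continuousAt.eventually_ne h0] with y hy
    rw [divDiff, if_neg hy]
    rfl

variable {P} [ActsOrthogonally P] {b : P.Base} {Γ₀ : Set b.support} {x₀ : Fin N → ℂ}

theorem IsGeneric.eq_zero (h : IsGeneric b Γ₀ x₀) {x : Fin N → ℂ} (hx : x ∈ orbit P x₀) (i : ι)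
    (he : Complex.exp (croot P i ⬝ᵥ x) = 1) : croot P i ⬝ᵥ x = 0 := by
  obtain ⟨w, hw, rfl⟩ := hx
  obtain ⟨k, hk⟩ := weyl_croot P (inv_mem hw) i
  have h1 : croot P i = w (croot P k) := by rw [← hk]; exact (w.apply_symm_apply _).symm
  rw [h1, weyl_dotProduct P hw] at he ⊢
  have h2 : ∀ v ∈ Submodule.span ℂ ((fun j : b.support => croot P j) '' Γ₀), v ⬝ᵥ x₀ = 0 := by
    intro v hv
    induction hv using Submodule.span_induction with
    | mem v hv => obtain ⟨j, hj, rfl⟩ := hv; exact h.mem_plane j hj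
    | zero => exact zero_dotProduct _
    | add v v' _ _ h3 h4 => rw [add_dotProduct, h3, h4, add_zero]
    | smul a v _ h3 => rw [smul_dotProduct, h3, smul_zero]
  exact h2 _ (h.mem_span k he)

/-- The operator `(1 - e^{-(α, x)})⁻¹ (1 - s_α)`, `α = α_i`, on germs near the orbit of a generic
point. -/
def localDiff (h : IsGeneric b Γ₀ x₀) (i : ι) : LocalOperator (orbit P x₀) where
  toFun := divDiff P i
  analytic f hf x hx := analyticAt_divDiff P i (hf x hx) (hf _ (weyl_mem_orbit P (refl_mem P i) hx))
    (h.eq_zero hx i)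
  congr f g hfg x hx := by
    filter_upwards [(hfg x hx).eventuallyEq_nhds, (tendsto_linearEquiv (refl P i) x).eventually
      (hfg _ (weyl_mem_orbit P (refl_mem P i) hx))] with y h1 h2
    rw [divDiff, divDiff, h1.fderiv_eq, h1.self_of_nhds, h2]
  add f g hf hg x hx := by
    filter_upwards [(hf x hx).eventually_analyticAt, (hg x hx).eventually_analyticAt] with y h1 h2
    simp only [divDiff, Pi.add_apply, fderiv_add h1.differentiableAt h2.differentiableAt,
      add_apply]
    split_ifs <;> ring
  smul a f hf x hx := by
    filter_upwards [(hf x hx).eventually_analyticAt] with y h1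
    simp only [divDiff, Pi.smul_apply, fderiv_const_smul h1.differentiableAt, smul_apply,
      smul_eq_mul]
    split_ifs <;> ring

theorem localDiff_spec (h : IsGeneric b Γ₀ x₀) (i : ι) (f : (Fin N → ℂ) → ℂ) :
    ∀ x ∈ orbit P x₀, ∀ᶠ y in 𝓝 x,
      (1 - Complex.exp (-(croot P i ⬝ᵥ y))) * (localDiff h i).toFun f y =
        f y - f (refl P i y) := by
  intro x hx
  have hl := (analyticAt_dotProduct (croot P i) x).continuousAt
  by_cases hx0 : croot P i ⬝ᵥ x = 0
  · obtain ⟨u, hu, hu0, hue⟩ := exists_analytic_exp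
    have hux : u (croot P i ⬝ᵥ x) ≠ 0 := by rw [hx0, hu0]; exact one_ne_zero
    have := ((hu (croot P i ⬝ᵥ x)).continuousAt.comp
      (f := fun y => croot P i ⬝ᵥ y) hl).eventually_ne hux
    filter_upwards [this] with y hy
    change (1 - Complex.exp (-(croot P i ⬝ᵥ y))) * divDiff P i f y = _
    rw [divDiff]
    split_ifs with hy0
    · rw [refl_eq_self P hy0, hy0]; simp
    · rw [mul_div_cancel₀]
      rw [hue]
      exact mul_ne_zero hy0 hy
  · have hc : ContinuousAt (fun y => 1 - Complex.exp (-(croot P i ⬝ᵥ y))) x := by fun_prop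
    have hexp : 1 - Complex.exp (-(croot P i ⬝ᵥ x)) ≠ 0 := by
      rw [Complex.exp_neg, sub_ne_zero]
      intro he
      exact hx0 (h.eq_zero hx i (by rw [← inv_inv (Complex.exp _), ← he, inv_one]))
    filter_upwards [hl.eventually_ne hx0, hc.eventually_ne hexp] with y hy hy'
    change (1 - Complex.exp (-(croot P i ⬝ᵥ y))) * divDiff P i f y = _
    rw [divDiff, if_neg hy, mul_div_cancel₀ _ hy']

variable [P.IsCrystallographic] [Fintype ι]

open Classical in
/-- The trigonometric Dunkl operator `∇_ξ` on germs near the orbit of a generic point. -/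
def germDunkl (h : IsGeneric b Γ₀ x₀) (c : ι → ℂ) (ξ : Fin N → ℂ) :
    Module.End ℂ (analyticGerms (orbit P x₀)) :=
  (localDeriv _ ξ).toEnd -
    ∑ i with b.IsPos i, (c i * (croot P i ⬝ᵥ ξ)) • (localDiff h i).toEnd +
    (weylVector b c ⬝ᵥ ξ) • LinearMap.id

/-- The generators as operators on germs near the orbit of a generic point. -/
def germGenerator (h : IsGeneric b Γ₀ x₀) (c : ι → ℂ) :
    Generator P → Module.End ℂ (analyticGerms (orbit P x₀))
  | .weyl w => (localWeyl P x₀ w).toEnd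
  | .exp μ => (localExp _ μ).toEnd
  | .dunkl ξ => germDunkl h c ξ

variable (U : Type*) [AddCommGroup U] [Module ℂ U]

/-- The action of the trigonometric Cherednik algebra on germs with values in `U`: the element `h`
acts by `T` if some noncommutative polynomial in the generators represents `h` on the group
algebra of the weight lattice, and the same polynomial in the generators acting on scalar germs,
tensored with the identity of `U`, is `T`. -/
def ActsBy (hx : IsGeneric b Γ₀ x₀) (c : ι → ℂ)
    (h : trigCherednikAlgebra b c) (T : Module.End ℂ (U ⊗[ℂ] analyticGerms (orbit P x₀))) : Prop :=
  ∃ a : FreeAlgebra ℂ (Generator P),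
    FreeAlgebra.lift ℂ (polyGenerator b c) a = h ∧
    (FreeAlgebra.lift ℂ (germGenerator hx c) a).lTensor U = T

theorem exists_actsBy (hx : IsGeneric b Γ₀ x₀) (c : ι → ℂ) (h : trigCherednikAlgebra b c) :
    ∃ T, ActsBy U hx c h T := by
  have h1 : h.1 ∈ Algebra.adjoin ℂ (Set.range (polyGenerator b c)) := h.2
  rw [Algebra.adjoin_range_eq_range_freeAlgebra_lift] at h1
  obtain ⟨a, ha⟩ := h1
  exact ⟨_, a, ha, rfl⟩

/-- A subspace of the `U`-valued germs is invariant under the trigonometric Cherednik algebra. -/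
def IsInvariant (hx : IsGeneric b Γ₀ x₀) (c : ι → ℂ)
    (I : Submodule ℂ (U ⊗[ℂ] analyticGerms (orbit P x₀))) : Prop :=
  ∀ (h : trigCherednikAlgebra b c) (T : Module.End ℂ (U ⊗[ℂ] analyticGerms (orbit P x₀))),
    ActsBy U hx c h T → ∀ F ∈ I, T F ∈ I

/-- Restriction of germs along `O` to the subset `D` of `V`. -/
def restrictGerm (O D : Set (Fin N → ℂ)) :
    analyticGerms O →ₗ[ℂ] Filter.Germ (𝓝ˢ O ⊓ Filter.principal D) ℂ where
  toFun g := g.1.compTendsto id (Filter.tendsto_id.mono_left inf_le_left)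
  map_add' := by rintro ⟨_, f, hf, rfl⟩ ⟨_, g, hg, rfl⟩; rfl
  map_smul' := by rintro a ⟨_, f, hf, rfl⟩; rfl

end Germs

section

variable {N : ℕ} {ι Y : Type*} [AddCommGroup Y] [Module ℝ Y]
  {P : RootPairing ι ℝ (Fin N → ℝ) Y} (b : P.Base) (Γ₀ : Set b.support) (x₀ : Fin N → ℂ)
  (U : Type*) [AddCommGroup U] [Module ℂ U]

/-- The space `𝓘_{Γ₀}` of germs on `V` near `W x₀`, with values in `U`, whose restriction to the
stratum `D_{Γ₀}` is zero. -/
def parabolicSubmodule : Submodule ℂ (U ⊗[ℂ] analyticGerms (orbit P x₀)) :=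
  LinearMap.ker ((restrictGerm (orbit P x₀) (stratum b Γ₀)).lTensor U)

end

end TrigCherednik

end

/-!
Invariance is reduced to scalar germs, because `ℂ`-vector spaces are flat and `U ≠ 0`, and to the
Dunkl operators, because `W` and the exponentials visibly preserve vanishing on the `W`-stable set
`D_{Γ₀}` (`isInvariant_iff`). If `f` vanishes on `D_{Γ₀}`, all difference quotients in `∇_ξ f` vanish
at a point `y` of `D_{Γ₀}`, except those for the roots orthogonal to `y`, where they degenerate to
derivatives. Hence (`dunklFun_eq_fderiv`)
`(∇_ξ f)(y) = df_y (ξ - A_y ξ)`, with `A_y ξ = ∑_{(α, y) = 0} c_α (α, ξ) / (α, α) α`.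

At a generic point of `π` the roots orthogonal to `y` are those in the span of `Γ₀`; write `A` for
`A_y` there. Invariance is equivalent to `ξ - A ξ ∈ π` for all `ξ`:
* if this holds, `ξ - A ξ` is tangent to `π`, so `∇_ξ f` vanishes at generic points of `π` and,
  by `W`-equivariance, at generic points of `D_{Γ₀}`; then it vanishes on `D_{Γ₀}` by continuity
  (`dunklFun_eq_zero`);
* conversely, for `v` in the span of `Γ₀` the polynomial `(v, y) ∏ (α, y)`, with `α` running over
  the roots outside this span, vanishes on `D_{Γ₀}`, and its derivative at a generic point of `π`
  is a non-zero multiple of `(v, ·)`, so `(v, ξ - A ξ) = 0` (`rootSum_dotProduct_eq_of_dunklFun`).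

Finally, a root in the span of `Γ₀` lies in one of the pairwise orthogonal spaces `V_i`
(`exists_component_of_mem_parabolicSpan`), so `A` splits into the analogous operators of the
components; as the form is nondegenerate on each `V_i`, the condition `ξ - A ξ ∈ π` becomes the
stated identities (`component_identity_iff`).
-/

noncomputable section

namespace TrigCherednik

/-! ### Roots in the span of a set of simple roots -/

section Roots

variable {N : ℕ} {ι Y : Type*} [AddCommGroup Y] [Module ℝ Y]
  {P : RootPairing ι ℝ (Fin N → ℝ) Y} (b : P.Base) (Γ₀ : Set b.support)

/-- The span of the simple roots of `Γ₀` in `V`. -/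
def parabolicSpan : Submodule ℂ (Fin N → ℂ) :=
  Submodule.span ℂ ((fun j : b.support => croot P j) '' Γ₀)

/-- A family of real vectors dual to the simple roots, i.e. fundamental coweights. -/
structure IsDualFamily (z : b.support → Fin N → ℝ) : Prop where
  self : ∀ i : b.support, P.root i ⬝ᵥ z i = 1
  ne : ∀ i j : b.support, i ≠ j → P.root i ⬝ᵥ z j = 0

theorem exists_isDualFamily : ∃ z, IsDualFamily b z := by
  have hli : LinearIndependent ℝ (fun i : b.support => P.root i) := b.linearIndepOn_root
  obtain ⟨g, hg⟩ := (Finsupp.linearCombination ℝ fun i : b.support =>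
    P.root i).exists_leftInverse_of_injective (LinearMap.ker_eq_bot.2 hli)
  have key : ∀ i j : b.support, P.root i ⬝ᵥ (fun k => g (Pi.single k 1) j) =
      Finsupp.single i (1 : ℝ) j := fun i j => by
    have h1 : g (P.root i) = Finsupp.single i 1 := by
      simpa using LinearMap.congr_fun hg (Finsupp.single i 1)
    have h2 : g (P.root i) = ∑ k, P.root i k • g (Pi.single k 1) := by
      conv_lhs => rw [← Finset.univ_sum_single (P.root i)]
      rw [map_sum]
      refine Finset.sum_congr rfl fun k _ => ?_
      rw [← map_smul, ← Pi.single_smul', smul_eq_mul, mul_one]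
    rw [← h1, h2, Finsupp.finsetSum_apply]
    rfl
  refine ⟨fun j k => g (Pi.single k 1) j, fun i => ?_, fun i j hij => ?_⟩
  · rw [key, Finsupp.single_eq_same]
  · rw [key, Finsupp.single_eq_of_ne' hij]

variable {b Γ₀}

theorem IsDualFamily.nonneg [Finite ι] [P.IsCrystallographic] {z : b.support → Fin N → ℝ}
    (hz : IsDualFamily b z) {i : ι} (hi : b.IsPos i) (j : b.support) : 0 ≤ P.root i ⬝ᵥ z j := by
  have hs : ∀ i ∈ b.support, 0 ≤ P.root i ⬝ᵥ z j := fun i hi => by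
    by_cases h : ⟨i, hi⟩ = j
    · exact (congrArg z h ▸ hz.self ⟨i, hi⟩).symm ▸ zero_le_one
    · exact (hz.ne ⟨i, hi⟩ j h).ge
  refine hi.induction_on_add hs fun i j k hk h1 hj => ?_
  rw [hk, add_dotProduct]
  exact add_nonneg h1 (hs j hj)

theorem croot_dotProduct_ofReal_eq_zero (i : ι) (x : Fin N → ℝ) :
    (croot P i ⬝ᵥ fun k => (x k : ℂ)) = 0 ↔ P.root i ⬝ᵥ x = 0 := by
  rw [croot_dotProduct_ofReal, Complex.ofReal_eq_zero]

theorem dotProduct_eq_zero_of_mem_span {S : Set (Fin N → ℂ)} {y v : Fin N → ℂ}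
    (h : ∀ s ∈ S, s ⬝ᵥ y = 0) (hv : v ∈ Submodule.span ℂ S) : v ⬝ᵥ y = 0 := by
  have : Submodule.span ℂ S ≤ LinearMap.ker ((dotProductBilin ℂ ℂ).flip y) :=
    Submodule.span_le.2 h
  exact this hv

theorem croot_mem_componentSpace (j : Γ₀) :
    croot P j ∈ componentSpace (((coxeterGraph b).induce Γ₀).connectedComponentMk j) :=
  Submodule.subset_span ⟨j, rfl, rfl⟩

theorem componentSpace_le (C : ((coxeterGraph b).induce Γ₀).ConnectedComponent) :
    componentSpace C ≤ parabolicSpan b Γ₀ := by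
  refine Submodule.span_mono ?_
  rintro _ ⟨j, -, rfl⟩
  exact ⟨j, j.2, rfl⟩

theorem dotProduct_eq_zero_of_component_ne
    {C D : ((coxeterGraph b).induce Γ₀).ConnectedComponent} (h : C ≠ D) {u v : Fin N → ℂ}
    (hu : u ∈ componentSpace C) (hv : v ∈ componentSpace D) : u ⬝ᵥ v = 0 := by
  refine dotProduct_eq_zero_of_mem_span ?_ hu
  rintro _ ⟨j, hj, rfl⟩
  rw [dotProduct_comm]
  refine dotProduct_eq_zero_of_mem_span ?_ hv
  rintro _ ⟨k, hk, rfl⟩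
  by_contra hne
  apply h
  rw [← hj, ← hk, SimpleGraph.ConnectedComponent.eq]
  refine SimpleGraph.Adj.reachable ⟨?_, ?_⟩
  · intro he
    have he : j = k := Subtype.ext he
    exact h (by rw [← hj, ← hk, he])
  · rw [croot_dotProduct_croot, dotProduct_comm] at hne
    exact_mod_cast hne

theorem star_mem_componentSpace {C : ((coxeterGraph b).induce Γ₀).ConnectedComponent}
    {a : Fin N → ℂ} (ha : a ∈ componentSpace C) : star a ∈ componentSpace C := by
  induction ha using Submodule.span_induction with
  | mem v hv =>
    obtain ⟨j, hj, rfl⟩ := hv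
    have : star (croot P j) = croot P j := by ext k; simp [croot]
    exact this ▸ Submodule.subset_span ⟨j, hj, rfl⟩
  | zero => simp
  | add v w _ _ hv hw => rw [star_add]; exact add_mem hv hw
  | smul t v _ hv => rw [star_smul]; exact Submodule.smul_mem _ _ hv

open scoped ComplexOrder in
/-- The bilinear form is nondegenerate on `V_C`, which is spanned by real vectors. -/
theorem eq_zero_of_mem_componentSpace {C : ((coxeterGraph b).induce Γ₀).ConnectedComponent}
    {a : Fin N → ℂ} (ha : a ∈ componentSpace C) (h : ∀ v ∈ componentSpace C, a ⬝ᵥ v = 0) :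
    a = 0 :=
  dotProduct_self_star_eq_zero.1 (h _ (star_mem_componentSpace ha))

/-- A dual family vector of a simple root outside a component is orthogonal to that component. -/
theorem IsDualFamily.dotProduct_component {z : b.support → Fin N → ℝ} (hz : IsDualFamily b z)
    {C : ((coxeterGraph b).induce Γ₀).ConnectedComponent} {j : b.support}
    (hj : ∀ k : Γ₀, k.1 = j → k ∉ C.supp) {i : ι} (hi : croot P i ∈ componentSpace C) :
    P.root i ⬝ᵥ z j = 0 := by
  rw [← croot_dotProduct_ofReal_eq_zero]
  refine dotProduct_eq_zero_of_mem_span ?_ hi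
  rintro _ ⟨k, hk, rfl⟩
  refine (croot_dotProduct_ofReal_eq_zero _ _).2 (hz.ne _ _ ?_)
  rintro rfl
  exact hj k rfl hk

theorem root_reflectionPerm_self (i : ι) : P.root (P.reflectionPerm i i) = -P.root i := by
  rw [P.root_reflectionPerm, P.reflection_apply_self]

theorem croot_reflectionPerm_self (i : ι) : croot P (P.reflectionPerm i i) = -croot P i := by
  ext k
  simp [croot]

variable [Finite ι] [P.IsCrystallographic] [P.IsReduced] [ActsOrthogonally P]

/-- The support of a root is connected: if `α` is a root in `V_C`, and `α + β` is a root with `β`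
simple, then `β` belongs to `C`; otherwise `s_β (α + β) = α - β` would be a positive root with a
negative coefficient. -/
theorem mem_supp_of_root_add {z : b.support → Fin N → ℝ} (hz : IsDualFamily b z)
    {C : ((coxeterGraph b).induce Γ₀).ConnectedComponent} {i k : ι} {j : Γ₀} (hi : b.IsPos i)
    (hk : P.root k = P.root i + P.root j) (hC : croot P i ∈ componentSpace C) : j ∈ C.supp := by
  by_contra hj
  have hkj : k ≠ j := by
    rintro rfl
    exact P.ne_zero i (by simpa using hk)
  have hpos := hz.nonneg
    ((hi.add (RootPairing.Base.isPos_of_mem_support j.1.2) hk).reflectionPerm j.1.2 hkj) j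
  have hort : P.root j ⬝ᵥ P.root i = 0 := by
    have := dotProduct_eq_zero_of_component_ne (Ne.symm hj) hC (croot_mem_componentSpace j)
    rw [croot_dotProduct_croot, dotProduct_comm] at this
    exact_mod_cast this
  have hz0 : P.root i ⬝ᵥ z j = 0 :=
    hz.dotProduct_component (fun l hl => by rwa [Subtype.ext hl]) hC
  have hne := root_dotProduct_self_ne_zero P (j : ι)
  rw [P.root_reflectionPerm, P.reflection_apply, coroot'_eq, hk, dotProduct_add, hort, zero_add,
    div_mul_cancel₀ _ hne, sub_dotProduct, add_dotProduct, smul_dotProduct, hz0, hz.self] at hpos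
  norm_num at hpos

/-- A root whose coefficients at the simple roots outside `Γ₀` vanish lies in the span of a single
component of `Γ₀`. -/
theorem IsDualFamily.exists_component {z : b.support → Fin N → ℝ} (hz : IsDualFamily b z) (i : ι)
    (h : ∀ j ∉ Γ₀, P.root i ⬝ᵥ z j = 0) :
    ∃ C : ((coxeterGraph b).induce Γ₀).ConnectedComponent, croot P i ∈ componentSpace C := by
  have main : ∀ i, b.IsPos i → (∀ j ∉ Γ₀, P.root i ⬝ᵥ z j = 0) →
      ∃ C : ((coxeterGraph b).induce Γ₀).ConnectedComponent, croot P i ∈ componentSpace C := by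
    intro i hi h
    refine (hi.induction_on_add (p := fun i => b.IsPos i ∧ ((∀ j ∉ Γ₀, P.root i ⬝ᵥ z j = 0) →
        ∃ C : ((coxeterGraph b).induce Γ₀).ConnectedComponent, croot P i ∈ componentSpace C))
      (fun i hi => ?_) fun i j k hk ih hj => ?_).2 h
    · refine ⟨RootPairing.Base.isPos_of_mem_support hi, fun h0 => ?_⟩
      have hmem : (⟨i, hi⟩ : b.support) ∈ Γ₀ := by
        by_contra hn
        exact one_ne_zero ((hz.self ⟨i, hi⟩).symm.trans (h0 _ hn))
      exact ⟨_, croot_mem_componentSpace ⟨_, hmem⟩⟩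
    · have hjpos := RootPairing.Base.isPos_of_mem_support hj
      refine ⟨ih.1.add hjpos hk, fun h0 => ?_⟩
      have h1 : ∀ l ∉ Γ₀, P.root i ⬝ᵥ z l = 0 ∧ P.root j ⬝ᵥ z l = 0 := by
        intro l hl
        have h2 := h0 l hl
        rw [hk, add_dotProduct] at h2
        exact (add_eq_zero_iff_of_nonneg (hz.nonneg ih.1 l) (hz.nonneg hjpos l)).1 h2
      have hmem : (⟨j, hj⟩ : b.support) ∈ Γ₀ := by
        by_contra hn
        exact one_ne_zero ((hz.self ⟨j, hj⟩).symm.trans (h1 _ hn).2)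
      obtain ⟨C, hC⟩ := ih.2 fun l hl => (h1 l hl).1
      have hjC := mem_supp_of_root_add (j := ⟨⟨j, hj⟩, hmem⟩) hz ih.1 hk hC
      refine ⟨C, ?_⟩
      have h3 : croot P k = croot P i + croot P j := by ext l; simp [croot, hk]
      rw [h3]
      exact add_mem hC (Submodule.subset_span ⟨_, hjC, rfl⟩)
  rcases RootPairing.Base.IsPos.or_neg b i with hi | hi
  · exact main i hi h
  · obtain ⟨C, hC⟩ := main _ hi fun j hj => by
      rw [RootPairing.indexNeg_neg, root_reflectionPerm_self, neg_dotProduct, h j hj, neg_zero]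
    refine ⟨C, ?_⟩
    rwa [RootPairing.indexNeg_neg, croot_reflectionPerm_self, neg_mem_iff] at hC

variable (Γ₀) in
/-- A generic vector of the plane `π`: it is orthogonal exactly to the roots in the span of the
simple roots of `Γ₀`. It can be chosen as the sum of the fundamental coweights outside `Γ₀`. -/
theorem exists_generic_direction :
    ∃ z ∈ plane b Γ₀, ∀ i, croot P i ⬝ᵥ z = 0 ↔ croot P i ∈ parabolicSpan b Γ₀ := by
  classical
  obtain ⟨z, hz⟩ := exists_isDualFamily b
  have hplane : (fun k => ((∑ j with j ∉ Γ₀, z j) k : ℂ)) ∈ plane b Γ₀ := by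
    intro i hi
    rw [croot_dotProduct_ofReal_eq_zero, dotProduct_sum]
    refine Finset.sum_eq_zero fun j hj => ?_
    refine hz.ne _ _ ?_
    rintro rfl
    exact (Finset.mem_filter.1 hj).2 hi
  refine ⟨_, hplane, fun i => ⟨fun h => ?_, dotProduct_eq_zero_of_mem_span ?_⟩⟩
  · rw [croot_dotProduct_ofReal_eq_zero, dotProduct_sum] at h
    have h1 : ∀ j ∈ Finset.univ.filter fun j : b.support => j ∉ Γ₀, P.root i ⬝ᵥ z j = 0 := by
      rcases RootPairing.Base.IsPos.or_neg b i with hi | hi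
      · exact (Finset.sum_eq_zero_iff_of_nonneg fun j _ => hz.nonneg hi j).1 h
      · refine (Finset.sum_eq_zero_iff_of_nonpos fun j _ => ?_).1 h
        have := hz.nonneg hi j
        rw [RootPairing.indexNeg_neg, root_reflectionPerm_self, neg_dotProduct] at this
        linarith
    obtain ⟨C, hC⟩ := hz.exists_component (Γ₀ := Γ₀) i fun j hj =>
      h1 j (Finset.mem_filter.2 ⟨Finset.mem_univ _, hj⟩)
    exact componentSpace_le C hC
  · rintro _ ⟨j, hj, rfl⟩
    exact hplane j hj

theorem exists_component_of_mem_parabolicSpan {i : ι} (h : croot P i ∈ parabolicSpan b Γ₀) :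
    ∃ C : ((coxeterGraph b).induce Γ₀).ConnectedComponent, croot P i ∈ componentSpace C := by
  obtain ⟨z, hz⟩ := exists_isDualFamily b
  refine hz.exists_component i fun j hj => ?_
  rw [← croot_dotProduct_ofReal_eq_zero]
  refine dotProduct_eq_zero_of_mem_span ?_ h
  rintro _ ⟨k, hk, rfl⟩
  refine (croot_dotProduct_ofReal_eq_zero _ _).2 (hz.ne _ _ ?_)
  rintro rfl
  exact hj hk

end Roots

/-! ### The bilinear identity -/

section Form

variable {N : ℕ} {ι Y : Type*} [AddCommGroup Y] [Module ℝ Y] [Fintype ι]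
  {P : RootPairing ι ℝ (Fin N → ℝ) Y} {b : P.Base} {Γ₀ : Set b.support} (c : ι → ℂ)

open Classical in
/-- The vector `∑ c_α (α, ξ) / (α, α) α`, the sum running over the roots `α_i` with `i ∈ S`. -/
def rootSum (S : Set ι) (ξ : Fin N → ℂ) : Fin N → ℂ :=
  ∑ i with i ∈ S, (c i * (croot P i ⬝ᵥ ξ) / (croot P i ⬝ᵥ croot P i)) • croot P i

open Classical in
theorem rootSum_dotProduct (S : Set ι) (ξ v : Fin N → ℂ) :
    rootSum (P := P) c S ξ ⬝ᵥ v = ∑ i with i ∈ S,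
      c i * (croot P i ⬝ᵥ ξ) * (croot P i ⬝ᵥ v) / (croot P i ⬝ᵥ croot P i) := by
  rw [rootSum, sum_dotProduct]
  refine Finset.sum_congr rfl fun i _ => ?_
  rw [smul_dotProduct, smul_eq_mul]
  ring

theorem rootSum_dotProduct_comm (S : Set ι) (ξ v : Fin N → ℂ) :
    rootSum (P := P) c S ξ ⬝ᵥ v = rootSum (P := P) c S v ⬝ᵥ ξ := by
  rw [rootSum_dotProduct, rootSum_dotProduct]
  exact Finset.sum_congr rfl fun i _ => by ring

variable [P.IsCrystallographic] [P.IsReduced] [ActsOrthogonally P]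

/-- On `V_C` only the roots in `V_C` contribute to the sum over all roots in the span of `Γ₀`. -/
theorem rootSum_parabolicSpan {C : ((coxeterGraph b).induce Γ₀).ConnectedComponent}
    {ξ : Fin N → ℂ} (hξ : ξ ∈ componentSpace C) :
    rootSum (P := P) c {i | croot P i ∈ parabolicSpan b Γ₀} ξ =
      rootSum (P := P) c {i | croot P i ∈ componentSpace C} ξ := by
  classical
  symm
  refine Finset.sum_subset (fun i hi => ?_) fun i hi hi' => ?_
  · simp only [Finset.mem_filter, Set.mem_ofPred_eq] at hi ⊢
    exact ⟨hi.1, componentSpace_le C hi.2⟩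
  · simp only [Finset.mem_filter, Set.mem_ofPred_eq, Finset.mem_univ, true_and] at hi hi'
    obtain ⟨D, hD⟩ := exists_component_of_mem_parabolicSpan hi
    have : D ≠ C := by rintro rfl; exact hi' hD
    rw [dotProduct_eq_zero_of_component_ne this hD hξ, mul_zero, zero_div, zero_smul]

variable (Γ₀) in
/-- The identities on the components of `Γ₀` hold together exactly when `ξ ↦ ξ - rootSum ξ` maps
`V` into the orthogonal complement of the simple roots of `Γ₀`. -/
theorem component_identity_iff :
    (∀ C : ((coxeterGraph b).induce Γ₀).ConnectedComponent,
        ∀ u ∈ componentSpace C, ∀ v ∈ componentSpace C,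
          (open Classical in ∑ i with croot P i ∈ componentSpace C,
            c i * (croot P i ⬝ᵥ u) * (croot P i ⬝ᵥ v) / (croot P i ⬝ᵥ croot P i)) = u ⬝ᵥ v) ↔
      ∀ ξ, ∀ v ∈ parabolicSpan b Γ₀,
        rootSum (P := P) c {i | croot P i ∈ parabolicSpan b Γ₀} ξ ⬝ᵥ v = ξ ⬝ᵥ v := by
  classical
  have key : ∀ (C : ((coxeterGraph b).induce Γ₀).ConnectedComponent) (u v : Fin N → ℂ),
      (∑ i with croot P i ∈ componentSpace C,
        c i * (croot P i ⬝ᵥ u) * (croot P i ⬝ᵥ v) / (croot P i ⬝ᵥ croot P i)) =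
      rootSum (P := P) c {i | croot P i ∈ componentSpace C} u ⬝ᵥ v := fun C u v => by
    rw [rootSum_dotProduct]
    rfl
  simp only [key]
  constructor
  · intro h ξ v hv
    rw [dotProduct_comm _ v, dotProduct_comm ξ, ← sub_eq_zero, ← dotProduct_sub]
    refine dotProduct_eq_zero_of_mem_span ?_ hv
    rintro _ ⟨j, hj, rfl⟩
    have hjC := croot_mem_componentSpace (⟨j, hj⟩ : Γ₀)
    set C := ((coxeterGraph b).induce Γ₀).connectedComponentMk ⟨j, hj⟩
    -- By nondegeneracy, the identity on `C` says that the sum over the roots in `V_C` fixes `V_C`.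
    have hfix : rootSum (P := P) c {i | croot P i ∈ componentSpace C} (croot P j) = croot P j := by
      rw [← sub_eq_zero]
      refine eq_zero_of_mem_componentSpace (C := C) (sub_mem ?_ hjC) fun v hv => ?_
      · exact sum_mem fun i hi => Submodule.smul_mem _ _ (Finset.mem_filter.1 hi).2
      · rw [sub_dotProduct, sub_eq_zero]
        exact h C _ hjC v hv
    rw [dotProduct_sub, sub_eq_zero, dotProduct_comm, rootSum_dotProduct_comm,
      rootSum_parabolicSpan c hjC, hfix]
  · intro h C u hu v hv
    rw [← rootSum_parabolicSpan c hu]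
    exact h u v (componentSpace_le C hv)

end Form

/-! ### Invariant kernels after tensoring with a vector space -/

section Tensor

variable {K U G H : Type*} [Field K] [AddCommGroup U] [Module K U] [AddCommGroup G] [Module K G]
  [AddCommGroup H] [Module K H]

/-- Over a field `ker (U ⊗ r) = U ⊗ ker r`, so `U ⊗ T` preserves it as soon as `T` preserves
`ker r`. -/
theorem lTensor_mem_ker {r : G →ₗ[K] H} {T : Module.End K G}
    (h : ∀ g ∈ LinearMap.ker r, T g ∈ LinearMap.ker r) {F : U ⊗[K] G}
    (hF : F ∈ LinearMap.ker (r.lTensor U)) : T.lTensor U F ∈ LinearMap.ker (r.lTensor U) := by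
  obtain ⟨F', rfl⟩ := (Module.Flat.lTensor_exact U r.exact_subtype_ker_map F).1 hF
  have h1 : r ∘ₗ T ∘ₗ (LinearMap.ker r).subtype = 0 := by
    ext g
    exact h g g.2
  rw [LinearMap.mem_ker, ← LinearMap.comp_apply, ← LinearMap.comp_apply, ← LinearMap.lTensor_comp,
    ← LinearMap.lTensor_comp, LinearMap.comp_assoc, h1, LinearMap.lTensor_zero,
    LinearMap.zero_apply]

/-- The converse for `U ≠ 0`: test on `u ⊗ g` and apply a functional that does not vanish on `u`. -/
theorem mem_ker_of_lTensor [Nontrivial U] {r : G →ₗ[K] H} {T : Module.End K G}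
    (h : ∀ F ∈ LinearMap.ker (r.lTensor U), T.lTensor U F ∈ LinearMap.ker (r.lTensor U)) {g : G}
    (hg : g ∈ LinearMap.ker r) : T g ∈ LinearMap.ker r := by
  obtain ⟨u, hu⟩ := exists_ne (0 : U)
  obtain ⟨φ, hφ⟩ : ∃ φ : Module.Dual K U, φ u ≠ 0 := by
    by_contra! h0
    exact hu ((Module.forall_dual_apply_eq_zero_iff K u).1 h0)
  have h1 := h (u ⊗ₜ g) (by
    rw [LinearMap.mem_ker, LinearMap.lTensor_tmul, LinearMap.mem_ker.1 hg, TensorProduct.tmul_zero])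
  rw [LinearMap.mem_ker, LinearMap.lTensor_tmul, LinearMap.lTensor_tmul] at h1
  have h2 := congrArg ((TensorProduct.lid K H).toLinearMap ∘ₗ φ.rTensor H) h1
  simp only [LinearMap.comp_apply, LinearMap.rTensor_tmul, LinearEquiv.coe_coe,
    TensorProduct.lid_tmul, map_zero] at h2
  exact (smul_eq_zero.1 h2).resolve_left hφ

end Tensor

/-! ### The Weyl group and the stratum -/

section Stratum

variable {N : ℕ} {ι Y : Type*} [AddCommGroup Y] [Module ℝ Y]
  {P : RootPairing ι ℝ (Fin N → ℝ) Y} {b : P.Base} {Γ₀ : Set b.support}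

theorem weyl_mem_stratum {w : (Fin N → ℂ) ≃ₗ[ℂ] (Fin N → ℂ)} (hw : w ∈ weylGroup P)
    {y : Fin N → ℂ} (hy : y ∈ stratum b Γ₀) : w y ∈ stratum b Γ₀ := by
  simp only [stratum, Set.mem_iUnion] at hy ⊢
  obtain ⟨v, hv, p, hp, rfl⟩ := hy
  exact ⟨w * v, mul_mem hw hv, p, hp, rfl⟩

theorem mem_plane_iff {y : Fin N → ℂ} :
    y ∈ plane b Γ₀ ↔ ∀ v ∈ parabolicSpan b Γ₀, v ⬝ᵥ y = 0 := by
  refine ⟨fun h v => dotProduct_eq_zero_of_mem_span ?_, fun h i hi =>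
    h _ (Submodule.subset_span ⟨i, hi, rfl⟩)⟩
  rintro _ ⟨j, hj, rfl⟩
  exact h j hj

theorem add_smul_mem_plane {y z : Fin N → ℂ} (hy : y ∈ plane b Γ₀) (hz : z ∈ plane b Γ₀) (t : ℂ) :
    y + t • z ∈ plane b Γ₀ := fun i hi => by
  rw [dotProduct_add, dotProduct_smul, hy i hi, hz i hi, smul_zero, add_zero]

/-- Moving a point of `π` slightly in a generic direction of `π` makes it orthogonal only to the
roots in the span of `Γ₀`. -/
theorem eventually_generic [Finite ι] {p z : Fin N → ℂ} (hp : p ∈ plane b Γ₀) (hz : z ∈ plane b Γ₀)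
    (hzi : ∀ i, croot P i ⬝ᵥ z = 0 ↔ croot P i ∈ parabolicSpan b Γ₀) :
    ∀ᶠ t : ℂ in 𝓝[≠] 0, ∀ i,
      croot P i ⬝ᵥ (p + t • z) = 0 ↔ croot P i ∈ parabolicSpan b Γ₀ := by
  refine Filter.eventually_all.2 fun i => ?_
  by_cases hi : croot P i ∈ parabolicSpan b Γ₀
  · exact Filter.Eventually.of_forall fun t =>
      iff_of_true (mem_plane_iff.1 (add_smul_mem_plane hp hz t) _ hi) hi
  · have hne : croot P i ⬝ᵥ z ≠ 0 := mt (hzi i).1 hi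
    have ht : ∀ᶠ t : ℂ in 𝓝[≠] 0, t ≠ -(croot P i ⬝ᵥ p) / (croot P i ⬝ᵥ z) := by
      rcases eq_or_ne 0 (-(croot P i ⬝ᵥ p) / (croot P i ⬝ᵥ z)) with h0 | h0
      · rw [← h0]
        exact eventually_mem_nhdsWithin
      · exact (eventually_ne_nhds h0).filter_mono nhdsWithin_le_nhds
    filter_upwards [ht] with t ht
    refine iff_of_false (fun h => ht ?_) hi
    rw [dotProduct_add, dotProduct_smul, smul_eq_mul] at h
    rw [eq_div_iff hne]
    linear_combination h

variable [ActsOrthogonally P]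

/-- An element of `W` permutes the roots and preserves every `W`-invariant function on them. -/
theorem weyl_exists_perm {c : ι → ℂ} (hc : ∀ i j, c (P.reflectionPerm i j) = c j)
    {w : (Fin N → ℂ) ≃ₗ[ℂ] (Fin N → ℂ)} (hw : w ∈ weylGroup P) :
    ∃ σ : Equiv.Perm ι, ∀ i, w (croot P i) = croot P (σ i) ∧ c (σ i) = c i := by
  induction hw using Subgroup.closure_induction with
  | mem w h =>
    obtain ⟨i, rfl⟩ := h
    exact ⟨P.reflectionPerm i, fun j => ⟨refl_croot P i j, hc i j⟩⟩
  | one => exact ⟨1, fun i => ⟨rfl, rfl⟩⟩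
  | mul a b _ _ ha hb =>
    obtain ⟨σ, hσ⟩ := ha
    obtain ⟨τ, hτ⟩ := hb
    refine ⟨σ * τ, fun i => ⟨?_, (hσ _).2.trans (hτ i).2⟩⟩
    rw [LinearEquiv.mul_apply, (hτ i).1, (hσ _).1, Equiv.Perm.mul_apply]
  | inv a _ ha =>
    obtain ⟨σ, hσ⟩ := ha
    refine ⟨σ⁻¹, fun i => ⟨?_, ?_⟩⟩
    · have := (hσ (σ⁻¹ i)).1
      rw [Equiv.Perm.inv_def, Equiv.apply_symm_apply] at this
      rw [← this]
      exact a.symm_apply_apply _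
    · have := (hσ (σ⁻¹ i)).2
      rwa [Equiv.Perm.inv_def, Equiv.apply_symm_apply, eq_comm] at this

/-- Equivariance of `rootSum`; the set of roots is given by a predicate `q` on vectors, so that it
can be transported by `w`. -/
theorem weyl_rootSum [Fintype ι] {c : ι → ℂ} (hc : ∀ i j, c (P.reflectionPerm i j) = c j)
    {w : (Fin N → ℂ) ≃ₗ[ℂ] (Fin N → ℂ)} (hw : w ∈ weylGroup P) (q : (Fin N → ℂ) → Prop)
    (ξ : Fin N → ℂ) :
    w (rootSum (P := P) c {i | q (w (croot P i))} ξ) =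
      rootSum (P := P) c {i | q (croot P i)} (w ξ) := by
  classical
  obtain ⟨σ, hσ⟩ := weyl_exists_perm hc hw
  simp only [rootSum, map_sum, Finset.sum_filter, Set.mem_ofPred_eq]
  refine Fintype.sum_equiv σ _ _ fun i => ?_
  rw [apply_ite w, map_smul, map_zero]
  rw [← (hσ i).1, (hσ i).2, weyl_dotProduct P hw, weyl_dotProduct P hw]

end Stratum

/-! ### The Dunkl operators on the stratum -/

section Dunkl

variable {N : ℕ} {ι Y : Type*} [AddCommGroup Y] [Module ℝ Y]
  {P : RootPairing ι ℝ (Fin N → ℝ) Y} {b : P.Base} {Γ₀ : Set b.support} {x₀ : Fin N → ℂ}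

theorem restrictGerm_germOf_eq_zero {O D : Set (Fin N → ℂ)} {f : (Fin N → ℂ) → ℂ}
    {hf : AnalyticOnNhd ℂ f O} :
    restrictGerm O D (germOf f hf) = 0 ↔ ∀ x ∈ O, ∀ᶠ y in 𝓝 x, y ∈ D → f y = 0 := by
  have : restrictGerm O D (germOf f hf) = ((f : (Fin N → ℂ) → ℂ) : Filter.Germ _ ℂ) := rfl
  rw [this, ← Filter.Germ.coe_zero, Filter.Germ.coe_eq, Filter.EventuallyEq,
    Filter.eventually_inf_principal]
  simp only [Filter.Eventually, mem_nhdsSet_iff_forall]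
  rfl

variable [Fintype ι]

open Classical in
/-- The trigonometric Dunkl operator `∇_ξ` on functions; where the functions are analytic it
represents the operator on germs. -/
def dunklFun (b : P.Base) (c : ι → ℂ) (ξ : Fin N → ℂ) (f : (Fin N → ℂ) → ℂ) : (Fin N → ℂ) → ℂ :=
  (fun y => fderiv ℂ f y ξ) -
    ∑ i with b.IsPos i, (c i * (croot P i ⬝ᵥ ξ)) • divDiff P i f + (weylVector b c ⬝ᵥ ξ) • f

theorem sum_germOf {α : Type*} {O : Set (Fin N → ℂ)} (s : Finset α) (f : α → (Fin N → ℂ) → ℂ)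
    (hf : ∀ a, AnalyticOnNhd ℂ (f a) O) :
    ∑ a ∈ s, germOf (f a) (hf a) =
      germOf (∑ a ∈ s, f a) (Finset.analyticOnNhd_sum s fun a _ => hf a) := by
  classical
  induction s using Finset.induction_on with
  | empty => rfl
  | insert a s ha ih =>
    rw [Finset.sum_insert ha, ih]
    simp only [Finset.sum_insert ha]
    rfl

/-- A sum over positive roots of terms that do not change under `α ↦ -α` is half of the sum over
all roots. -/
theorem two_nsmul_sum_isPos [P.IsReduced] {E : Type*} [AddCommMonoid E] (t : ι → E)
    (ht : ∀ i, t (P.reflectionPerm i i) = t i) :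
    (open Classical in 2 • ∑ i with b.IsPos i, t i) = ∑ i, t i := by
  classical
  have hinv : ∀ i, P.reflectionPerm (P.reflectionPerm i i) (P.reflectionPerm i i) = i := fun i =>
    P.root.injective (by rw [root_reflectionPerm_self, root_reflectionPerm_self, neg_neg])
  rw [two_nsmul, ← Finset.sum_filter_add_sum_filter_not Finset.univ b.IsPos]
  congr 1
  refine Finset.sum_nbij' (fun i => P.reflectionPerm i i) (fun i => P.reflectionPerm i i)
    (fun i hi => ?_) (fun i hi => ?_) (fun i _ => hinv i) (fun i _ => hinv i)
    fun i _ => (ht i).symm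
  all_goals
    simp only [Finset.mem_filter, Finset.mem_univ, true_and, ← RootPairing.indexNeg_neg,
      RootPairing.Base.IsPos.neg_iff_not, not_not] at hi ⊢
    exact hi

/-- At a point `y` of the stratum, the Dunkl operator acts on functions vanishing at `y` and at the
reflections of `y` as the derivative in the direction `ξ - ∑ c_α (α, ξ) / (α, α) α`, the sum
running over the roots orthogonal to `y`. -/
theorem dunklFun_eq_fderiv [P.IsReduced] {c : ι → ℂ} (hc : ∀ i j, c (P.reflectionPerm i j) = c j)
    (ξ : Fin N → ℂ) {f : (Fin N → ℂ) → ℂ} {y : Fin N → ℂ} (hy : f y = 0)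
    (hs : ∀ i, f (refl P i y) = 0) :
    dunklFun b c ξ f y = fderiv ℂ f y (ξ - rootSum (P := P) c {i | croot P i ⬝ᵥ y = 0} ξ) := by
  classical
  have h1 : ∀ i, (c i * (croot P i ⬝ᵥ ξ)) * divDiff P i f y =
      2 * (if croot P i ⬝ᵥ y = 0 then fderiv ℂ f y
        ((c i * (croot P i ⬝ᵥ ξ) / (croot P i ⬝ᵥ croot P i)) • croot P i) else 0) := by
    intro i
    rw [divDiff]
    split_ifs
    · rw [map_smul, smul_eq_mul]
      ring
    · rw [hy, hs]
      simp
  have h2 := two_nsmul_sum_isPos (b := b) (fun i => if croot P i ⬝ᵥ y = 0 then fderiv ℂ f y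
    ((c i * (croot P i ⬝ᵥ ξ) / (croot P i ⬝ᵥ croot P i)) • croot P i) else 0) fun i => by
      simp only [croot_reflectionPerm_self, neg_dotProduct, neg_eq_zero, hc, dotProduct_neg,
        neg_neg, mul_neg, neg_div, neg_smul, smul_neg]
  rw [nsmul_eq_mul, Finset.mul_sum, Nat.cast_ofNat] at h2
  simp only [dunklFun, Pi.add_apply, Pi.sub_apply, Finset.sum_apply, Pi.smul_apply, smul_eq_mul,
    hy, mul_zero, add_zero, h1, h2, rootSum, map_sub, map_sum, Set.mem_ofPred_eq]
  rw [Finset.sum_filter]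

variable [ActsOrthogonally P]

theorem analyticOnNhd_dunklFun (h : IsGeneric b Γ₀ x₀) (c : ι → ℂ) (ξ : Fin N → ℂ)
    {f : (Fin N → ℂ) → ℂ} (hf : AnalyticOnNhd ℂ f (orbit P x₀)) :
    AnalyticOnNhd ℂ (dunklFun b c ξ f) (orbit P x₀) := by
  classical
  refine (((localDeriv _ ξ).analytic f hf).sub ?_).add fun x hx => analyticAt_const.smul (hf x hx)
  exact Finset.analyticOnNhd_sum _ fun i _ x hx =>
    analyticAt_const.smul ((localDiff h i).analytic f hf x hx)

/-- The test function `(v, y) ∏ (α, y)`, the product running over the roots outside the span of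
`Γ₀`, vanishes on the stratum: if `w` preserves the span of `Γ₀`, then `(v, ·)` vanishes on `w π`,
otherwise `w` moves a root of `Γ₀` out of the span. -/
theorem prod_eq_zero_of_mem_stratum {v : Fin N → ℂ} (hv : v ∈ parabolicSpan b Γ₀)
    {y : Fin N → ℂ} (hy : y ∈ stratum b Γ₀) :
    (v ⬝ᵥ y) * (open Classical in ∏ i with croot P i ∉ parabolicSpan b Γ₀, croot P i ⬝ᵥ y) = 0 := by
  classical
  simp only [stratum, Set.mem_iUnion] at hy
  obtain ⟨w, hw, p, hp, rfl⟩ := hy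
  by_cases hall : ∀ j ∈ Γ₀, w (croot P j) ∈ parabolicSpan b Γ₀
  · have hle : (parabolicSpan b Γ₀).map w.toLinearMap ≤ parabolicSpan b Γ₀ := by
      rw [Submodule.map_le_iff_le_comap]
      refine Submodule.span_le.2 ?_
      rintro _ ⟨j, hj, rfl⟩
      exact hall j hj
    have heq := Submodule.eq_of_le_of_finrank_eq hle (LinearEquiv.finrank_map_eq w _)
    rw [← heq] at hv
    obtain ⟨u, hu, rfl⟩ := hv
    have : w.toLinearMap u ⬝ᵥ w p = 0 :=
      (weyl_dotProduct P hw u p).trans (mem_plane_iff.1 hp u hu)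
    rw [this, zero_mul]
  · push Not at hall
    obtain ⟨j, hj, hjn⟩ := hall
    obtain ⟨k, hk⟩ := weyl_croot P hw j
    rw [Finset.prod_eq_zero (i := k), mul_zero]
    · exact Finset.mem_filter.2 ⟨Finset.mem_univ _, hk ▸ hjn⟩
    · rw [← hk, weyl_dotProduct P hw]
      exact hp j hj

theorem germDunkl_germOf (h : IsGeneric b Γ₀ x₀) (c : ι → ℂ) (ξ : Fin N → ℂ)
    {f : (Fin N → ℂ) → ℂ} (hf : AnalyticOnNhd ℂ f (orbit P x₀)) :
    germDunkl h c ξ (germOf f hf) =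
      germOf (dunklFun b c ξ f) (analyticOnNhd_dunklFun h c ξ hf) := by
  classical
  have ha : ∀ i, AnalyticOnNhd ℂ ((c i * (croot P i ⬝ᵥ ξ)) • divDiff P i f) (orbit P x₀) :=
    fun i x hx => analyticAt_const.smul ((localDiff h i).analytic f hf x hx)
  have h1 : ∀ i, ((c i * (croot P i ⬝ᵥ ξ)) • (localDiff h i).toEnd) (germOf f hf) =
      germOf ((c i * (croot P i ⬝ᵥ ξ)) • divDiff P i f) (ha i) := fun i =>
    congrArg ((c i * (croot P i ⬝ᵥ ξ)) • ·) ((localDiff h i).toEnd_germOf f hf)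
  rw [germDunkl, LinearMap.add_apply, LinearMap.sub_apply, LinearMap.sum_apply,
    LocalOperator.toEnd_germOf, Finset.sum_congr rfl fun i _ => h1 i, sum_germOf _ _ ha]
  rfl

variable [P.IsCrystallographic]

/-- If `ξ - rootSum ξ` is always tangent to the plane `π`, then the Dunkl operators preserve
vanishing on the stratum. At a generic point of the stratum the operator is a derivative along the
stratum, and every point of the stratum is a limit of generic ones. -/
theorem dunklFun_eq_zero [P.IsReduced] (h : IsGeneric b Γ₀ x₀) {c : ι → ℂ}
    (hc : ∀ i j, c (P.reflectionPerm i j) = c j)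
    (hA : ∀ ξ, ∀ v ∈ parabolicSpan b Γ₀,
        rootSum (P := P) c {i | croot P i ∈ parabolicSpan b Γ₀} ξ ⬝ᵥ v = ξ ⬝ᵥ v)
    (ξ : Fin N → ℂ) {f : (Fin N → ℂ) → ℂ} (hf : AnalyticOnNhd ℂ f (orbit P x₀))
    (h0 : ∀ x ∈ orbit P x₀, ∀ᶠ y in 𝓝 x, y ∈ stratum b Γ₀ → f y = 0) :
    ∀ x ∈ orbit P x₀, ∀ᶠ y in 𝓝 x, y ∈ stratum b Γ₀ → dunklFun b c ξ f y = 0 := by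
  intro x hx
  have hrefl : ∀ᶠ y in 𝓝 x, ∀ i, y ∈ stratum b Γ₀ → f (refl P i y) = 0 := by
    refine Filter.eventually_all.2 fun i => ?_
    filter_upwards [(tendsto_linearEquiv (refl P i) x).eventually
      (h0 _ (weyl_mem_orbit P (refl_mem P i) hx))] with y hy hys
    exact hy (weyl_mem_stratum (refl_mem P i) hys)
  filter_upwards [(h0 x hx).eventually_nhds.eventually_nhds, hrefl.eventually_nhds,
    (hf x hx).eventually_analyticAt.eventually_nhds,
    (analyticOnNhd_dunklFun h c ξ hf x hx).eventually_analyticAt] with y h1 h2 h3 h4 hy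
  simp only [stratum, Set.mem_iUnion] at hy
  obtain ⟨w, hw, p, hp, rfl⟩ := hy
  obtain ⟨z, hz, hzi⟩ := exists_generic_direction Γ₀
  have hcont : Filter.Tendsto (fun t : ℂ => w (p + t • z)) (𝓝[≠] 0) (𝓝 (w p)) := by
    have : Continuous fun t : ℂ => w (p + t • z) :=
      (LinearMap.toContinuousLinearMap (w : (Fin N → ℂ) →ₗ[ℂ] (Fin N → ℂ))).continuous.comp
        (by fun_prop)
    have h5 := this.tendsto 0
    rw [zero_smul, add_zero] at h5
    exact h5.mono_left nhdsWithin_le_nhds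
  refine tendsto_nhds_unique (h4.continuousAt.tendsto.comp hcont)
    (tendsto_const_nhds.congr' ?_)
  filter_upwards [eventually_generic hp hz hzi, hcont.eventually h1, hcont.eventually h2,
    hcont.eventually h3] with t ht h1 h2 h3
  have hpt := add_smul_mem_plane hp hz t
  have hmem : ∀ q ∈ plane b Γ₀, w q ∈ stratum b Γ₀ := fun q hq =>
    Set.mem_biUnion hw ⟨q, hq, rfl⟩
  have hwinv : ∀ v, w (w⁻¹ v) = v := w.apply_symm_apply
  have hS : {i | croot P i ⬝ᵥ w (p + t • z) = 0} =
      {i | w⁻¹ (croot P i) ∈ parabolicSpan b Γ₀} := by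
    ext i
    obtain ⟨k, hk⟩ := weyl_croot P (inv_mem hw) i
    simp only [Set.mem_ofPred_eq]
    rw [← hwinv (croot P i), weyl_dotProduct P hw, hwinv, hk, ht]
  have hdir : ξ - rootSum (P := P) c {i | croot P i ⬝ᵥ w (p + t • z) = 0} ξ =
      w (w⁻¹ ξ - rootSum (P := P) c {i | croot P i ∈ parabolicSpan b Γ₀} (w⁻¹ ξ)) := by
    have h5 := weyl_rootSum hc hw (fun v => w⁻¹ v ∈ parabolicSpan b Γ₀) (w⁻¹ ξ)
    have h6 : ∀ v, w⁻¹ (w v) = v := w.symm_apply_apply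
    simp only [h6] at h5
    rw [map_sub, h5, hwinv, hS]
  have htan : w⁻¹ ξ - rootSum (P := P) c {i | croot P i ∈ parabolicSpan b Γ₀} (w⁻¹ ξ) ∈
      plane b Γ₀ := mem_plane_iff.2 fun v hv => by
    rw [dotProduct_comm, sub_dotProduct, hA _ v hv, sub_self]
  have hys := hmem _ hpt
  rw [Function.comp_apply, dunklFun_eq_fderiv hc ξ (h1.self_of_nhds hys) (fun i => h2 i hys), hdir]
  set η := w⁻¹ ξ - rootSum (P := P) c {i | croot P i ∈ parabolicSpan b Γ₀} (w⁻¹ ξ)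
  -- `f` vanishes along the line through `w (p + t z)` in the direction `w η`.
  have hline := h3.differentiableAt.hasFDerivAt.hasLineDerivAt (w η)
  have hzero : (fun s : ℂ => f (w (p + t • z) + s • w η)) =ᶠ[𝓝 0] fun _ => 0 := by
    have h7 : Filter.Tendsto (fun s : ℂ => w (p + t • z) + s • w η) (𝓝 0)
        (𝓝 (w (p + t • z))) := by
      have h8 : Continuous fun s : ℂ => w (p + t • z) + s • w η := by fun_prop
      simpa using h8.tendsto 0
    filter_upwards [h7.eventually h1] with s hs
    refine hs ?_
    rw [← map_smul, ← map_add]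
    exact hmem _ (add_smul_mem_plane hpt htan s)
  exact ((hasDerivAt_const (0 : ℂ) (0 : ℂ)).congr_of_eventuallyEq hzero).unique hline

/-- If the Dunkl operators preserve vanishing on the stratum, then `ξ - rootSum ξ` is orthogonal to
the span of `Γ₀`: the test functions detect this at a generic point of `π` near `x₀`. -/
theorem rootSum_dotProduct_eq_of_dunklFun [P.IsReduced] (h : IsGeneric b Γ₀ x₀) {c : ι → ℂ}
    (hc : ∀ i j, c (P.reflectionPerm i j) = c j)
    (hI : ∀ (ξ : Fin N → ℂ) (f : (Fin N → ℂ) → ℂ), AnalyticOnNhd ℂ f (orbit P x₀) →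
      (∀ y ∈ stratum b Γ₀, f y = 0) →
      ∀ᶠ y in 𝓝 x₀, y ∈ stratum b Γ₀ → dunklFun b c ξ f y = 0)
    (ξ : Fin N → ℂ) {v : Fin N → ℂ} (hv : v ∈ parabolicSpan b Γ₀) :
    rootSum (P := P) c {i | croot P i ∈ parabolicSpan b Γ₀} ξ ⬝ᵥ v = ξ ⬝ᵥ v := by
  classical
  set g : (Fin N → ℂ) → ℂ := fun y => ∏ i with croot P i ∉ parabolicSpan b Γ₀, croot P i ⬝ᵥ y
    with hg
  have hga : ∀ y, AnalyticAt ℂ g y := fun y =>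
    Finset.analyticAt_fun_prod _ fun i _ => analyticAt_dotProduct _ _
  have hf0 : ∀ y ∈ stratum b Γ₀, (v ⬝ᵥ y) * g y = 0 := fun y hy =>
    prod_eq_zero_of_mem_stratum hv hy
  obtain ⟨z, hz, hzi⟩ := exists_generic_direction Γ₀
  have hcont : Filter.Tendsto (fun t : ℂ => x₀ + t • z) (𝓝[≠] 0) (𝓝 x₀) := by
    have h5 : Continuous fun t : ℂ => x₀ + t • z := by fun_prop
    have h6 := h5.tendsto 0
    rw [zero_smul, add_zero] at h6
    exact h6.mono_left nhdsWithin_le_nhds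
  obtain ⟨t, ht, htD⟩ := ((eventually_generic h.mem_plane hz hzi).and (hcont.eventually
    (hI ξ _ (fun x _ => (analyticAt_dotProduct v x).mul (hga x)) hf0))).exists
  have hpt := add_smul_mem_plane h.mem_plane hz t
  set y := x₀ + t • z
  have hys : y ∈ stratum b Γ₀ := Set.mem_biUnion (one_mem _) ⟨y, hpt, rfl⟩
  have hS : {i | croot P i ⬝ᵥ y = 0} = {i | croot P i ∈ parabolicSpan b Γ₀} := Set.ext ht
  have hgy : g y ≠ 0 := Finset.prod_ne_zero_iff.2 fun i hi hi0 =>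
    (Finset.mem_filter.1 hi).2 ((ht i).1 hi0)
  have hl : HasFDerivAt (fun y => v ⬝ᵥ y)
      (LinearMap.toContinuousLinearMap (dotProductBilin ℂ ℂ v)) y :=
    (LinearMap.toContinuousLinearMap (dotProductBilin ℂ ℂ v)).hasFDerivAt
  have h1 := htD hys
  rw [dunklFun_eq_fderiv hc ξ (hf0 y hys)
    (fun i => hf0 _ (weyl_mem_stratum (refl_mem P i) hys)), hS] at h1
  change fderiv ℂ ((fun y => v ⬝ᵥ y) * g) y _ = 0 at h1
  rw [(hl.mul (hga y).differentiableAt.hasFDerivAt).fderiv, add_apply, smul_apply, smul_apply,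
    mem_plane_iff.1 hpt v hv, zero_smul, zero_add, smul_eq_mul] at h1
  have h2 : v ⬝ᵥ (ξ - rootSum (P := P) c {i | croot P i ∈ parabolicSpan b Γ₀} ξ) = 0 :=
    (mul_eq_zero.1 h1).resolve_left hgy
  rw [dotProduct_sub, sub_eq_zero, dotProduct_comm, dotProduct_comm v] at h2
  exact h2.symm

/-- Invariance under the algebra means that the Dunkl operators preserve the vanishing on the
stratum. -/
theorem isInvariant_iff (h : IsGeneric b Γ₀ x₀) (c : ι → ℂ)
    (U : Type*) [AddCommGroup U] [Module ℂ U] [Nontrivial U] :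
    IsInvariant U h c (parabolicSubmodule b Γ₀ x₀ U) ↔
      ∀ (ξ : Fin N → ℂ) (f : (Fin N → ℂ) → ℂ), AnalyticOnNhd ℂ f (orbit P x₀) →
        (∀ x ∈ orbit P x₀, ∀ᶠ y in 𝓝 x, y ∈ stratum b Γ₀ → f y = 0) →
        ∀ x ∈ orbit P x₀, ∀ᶠ y in 𝓝 x, y ∈ stratum b Γ₀ → dunklFun b c ξ f y = 0 := by
  constructor
  · intro hI ξ f hf h0
    have hgen : polyGenerator b c (.dunkl ξ) ∈ trigCherednikAlgebra b c :=
      Algebra.subset_adjoin ⟨_, rfl⟩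
    have h1 := hI ⟨_, hgen⟩ _ ⟨FreeAlgebra.ι ℂ (.dunkl ξ), FreeAlgebra.lift_ι_apply _ _, rfl⟩
    rw [FreeAlgebra.lift_ι_apply] at h1
    have h2 := mem_ker_of_lTensor h1 (LinearMap.mem_ker.2
      (restrictGerm_germOf_eq_zero (hf := hf).2 h0))
    have h3 : germGenerator h c (.dunkl ξ) (germOf f hf) = _ := germDunkl_germOf h c ξ hf
    rw [h3] at h2
    exact restrictGerm_germOf_eq_zero.1 h2
  · rintro hD _ _ ⟨a, -, rfl⟩ F hF
    refine lTensor_mem_ker ?_ hF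
    induction a using FreeAlgebra.induction with
    | grade0 r =>
      intro g hg
      rw [AlgHom.commutes, Module.algebraMap_end_apply]
      exact Submodule.smul_mem _ _ hg
    | grade1 s =>
      rw [FreeAlgebra.lift_ι_apply]
      rintro ⟨_, f, hf, rfl⟩ hg
      change germOf f hf ∈ _ at hg
      have h0 := restrictGerm_germOf_eq_zero.1 (LinearMap.mem_ker.1 hg)
      change germGenerator h c s (germOf f hf) ∈ _
      cases s with
      | weyl w =>
        rw [germGenerator, LocalOperator.toEnd_germOf]
        refine restrictGerm_germOf_eq_zero.2 fun x hx => ?_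
        filter_upwards [(tendsto_linearEquiv w.1⁻¹ x).eventually
          (h0 _ (weyl_mem_orbit P (inv_mem w.2) hx))] with y hy hys
        exact hy (weyl_mem_stratum (inv_mem w.2) hys)
      | exp μ =>
        rw [germGenerator, LocalOperator.toEnd_germOf]
        refine restrictGerm_germOf_eq_zero.2 fun x hx => ?_
        filter_upwards [h0 x hx] with y hy hys
        change Complex.exp _ * f y = 0
        rw [hy hys, mul_zero]
      | dunkl ξ =>
        rw [germGenerator, germDunkl_germOf]
        exact restrictGerm_germOf_eq_zero.2 (hD ξ f hf h0)
    | mul a a' ha ha' =>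
      intro g hg
      rw [map_mul]
      exact ha _ (ha' g hg)
    | add a a' ha ha' =>
      intro g hg
      rw [map_add]
      exact add_mem (ha g hg) (ha' g hg)

end Dunkl

end TrigCherednik

end

open TrigCherednik in
theorem mainTheorem3 {N : ℕ} {ι Y : Type*} [Fintype ι] [AddCommGroup Y] [Module ℝ Y]
    (P : RootPairing ι ℝ (Fin N → ℝ) Y) [P.IsRootSystem] [P.IsCrystallographic] [P.IsReduced]
    [ActsOrthogonally P] (b : P.Base)
    (c : ι → ℂ) (hc : ∀ i j, c (P.reflectionPerm i j) = c j)
    (Γ₀ : Set b.support) (x₀ : Fin N → ℂ) (hx₀ : IsGeneric b Γ₀ x₀)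
    (U : Type*) [AddCommGroup U] [Module ℂ U] [Nontrivial U] :
    IsInvariant U hx₀ c (parabolicSubmodule b Γ₀ x₀ U) ↔
      ∀ C : ((coxeterGraph b).induce Γ₀).ConnectedComponent,
        ∀ u ∈ componentSpace C, ∀ v ∈ componentSpace C,
          (open Classical in ∑ i with croot P i ∈ componentSpace C,
            c i * (croot P i ⬝ᵥ u) * (croot P i ⬝ᵥ v) / (croot P i ⬝ᵥ croot P i)) = u ⬝ᵥ v := by
  rw [component_identity_iff, isInvariant_iff]
  refine ⟨fun hI ξ v hv => rootSum_dotProduct_eq_of_dunklFun hx₀ hc (fun ξ f hf h0 => ?_) ξ hv,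
    fun hA ξ f hf h0 => dunklFun_eq_zero hx₀ hc hA ξ hf h0⟩
  exact hI ξ f hf (fun x _ => Filter.Eventually.of_forall h0) x₀ ⟨1, one_mem _, rfl⟩
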